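/- **Proposition 4.1 (Mean Value Inequality).** Let $(X,J)$ be a smooth almost complex manifold (Hausdorff, second countable, finite-dimensional, without boundary) and let $g$ be a smooth Riemannian metric on $X$ compatible with $J$, i.e. $g(Jv,Jw)=g(v,w)$. For $x\in X$ and $r\in\mathbb R$ let $B^g_r(x)$ be the open ball of radius $r$ around $x$ for the Riemannian distance of $g$ (points in different components being at infinite distance), and let $$\mathcal D=\{(x,r)\in X\times\mathbb R:\ \overline{B^g_r(x)}\ \text{is compact}\}$$ (so $\mathcal D=X\times\mathbb R$ if $g$ is complete, in particular if $X$ is compact). For $R>0$ let $B_R\subset\mathbb C$ be the open disk of radius $R$ around $0$. For a smooth map $u:B_R\to X$ and $z=s+\mathfrak i t$ write $$|\mathrm d_zu|_g^2=|\partial_su(z)|_g^2+|\partial_tu(z)|_g^2,\qquad E_g(u)=\tfrac12\int_{B_R}|\mathrm d_zu|_g^2\,\mathrm ds\,\mathrm dt\in[0,\infty].$$ Then there exists a function $\hbar_{J,g}:X\times\mathbb R\to\mathbb R^+$, continuous on $\mathcal D$, with the following property. If $R>0$ and $u:B_R\to X$ is a $J$-holomorphic map (i.e. smooth with $\mathrm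 du\circ\mathfrak i=J\circ\mathrm du$) such that $$u(B_R)\subset B^g_r(x)\qquad\text{and}\qquad E_g(u)<\hbar_{J,g}(x,r)$$ for some $(x,r)\in\mathcal D$, then $$|\mathrm d_0u|_g^2\le\frac{16}{\pi R^2}E_g(u),$$ and the inequality is strict unless $u$ is constant. -/

import Mathlib

open Bundle Manifold MeasureTheory
open scoped ContDiff ENNReal

noncomputable section

section JHolomorphic

variable {E : Type*} [NormedAddCommGroup E] [NormedSpace ℝ E]
  {X : Type*} [TopologicalSpace X] [ChartedSpace E X] [IsManifold 𝓘(ℝ, E) ∞ X]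

variable (E X) in
/-- A smooth almost complex structure on the manifold `X`: a smooth section `J` of the
endomorphism bundle of the tangent bundle `TX` such that `J ∘ J = -Id`. -/
structure AlmostComplexStructure where
  /-- The endomorphism `J x` of the tangent space at `x`. -/
  toFun : ∀ x : X, TangentSpace 𝓘(ℝ, E) x →L[ℝ] TangentSpace 𝓘(ℝ, E) x
  smooth : ContMDiff 𝓘(ℝ, E) (𝓘(ℝ, E).prod 𝓘(ℝ, E →L[ℝ] E)) ∞
    (fun x : X ↦ (TotalSpace.mk' (E →L[ℝ] E) x (toFun x) :
      TotalSpace (E →L[ℝ] E)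
        (fun x : X ↦ TangentSpace 𝓘(ℝ, E) x →L[ℝ] TangentSpace 𝓘(ℝ, E) x)))
  sq_eq_neg : ∀ (x : X) (v : TangentSpace 𝓘(ℝ, E) x), toFun x (toFun x v) = -v

/-- `u` is a `J`-holomorphic map on the open set `U ⊆ ℂ`: it is smooth on `U` and its differential
intertwines multiplication by `i` on `ℂ` with `J`. -/
def IsJHolomorphicOn (J : AlmostComplexStructure E X) (u : ℂ → X) (U : Set ℂ) : Prop :=
  ContMDiffOn 𝓘(ℝ, ℂ) 𝓘(ℝ, E) ∞ u U ∧
    ∀ z ∈ U, ∀ v : ℂ, mfderiv 𝓘(ℝ, ℂ) 𝓘(ℝ, E) u z (Complex.I * v : ℂ) =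
      J.toFun (u z) (mfderiv 𝓘(ℝ, ℂ) 𝓘(ℝ, E) u z v)

variable [RiemannianBundle (fun x : X ↦ TangentSpace 𝓘(ℝ, E) x)]

/-- The Riemannian metric `g` on `X` (the inner product on the tangent spaces) is compatible with
`J`: `g(Jv, Jw) = g(v, w)`. -/
def AlmostComplexStructure.IsCompatible (J : AlmostComplexStructure E X) : Prop :=
  ∀ (x : X) (v w : TangentSpace 𝓘(ℝ, E) x), inner ℝ (J.toFun x v) (J.toFun x w) = inner ℝ v w

variable (E) in
/-- The open ball of radius `r` around `x` for the distance of the Riemannian metric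
(points in different components of `X` are at infinite distance). -/
def riemannianBall (x : X) (r : ℝ) : Set X :=
  {y : X | riemannianEDist 𝓘(ℝ, E) x y < ENNReal.ofReal r}

variable (E X) in
/-- The pairs `(x, r)` such that the Riemannian ball of radius `r` around `x` is relatively compact
in `X`. -/
def relativelyCompactBalls : Set (X × ℝ) :=
  {p | IsCompact (closure (riemannianBall E p.1 p.2))}

variable (E) in
/-- The square `|d_z u|² = |∂u/∂s|² + |∂u/∂t|²` of the norm of the differential of `u` at
`z = s + i t`, with respect to the Riemannian metric on `X` and the standard metric on `ℂ`. -/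
def normSqDifferential (u : ℂ → X) (z : ℂ) : ℝ :=
  ‖mfderiv 𝓘(ℝ, ℂ) 𝓘(ℝ, E) u z (1 : ℂ)‖ ^ 2 +
    ‖mfderiv 𝓘(ℝ, ℂ) 𝓘(ℝ, E) u z (Complex.I : ℂ)‖ ^ 2

variable (E) in
/-- The energy `½ ∫_U |du|² ∈ [0, ∞]` of `u` on `U ⊆ ℂ`. -/
def energy (u : ℂ → X) (U : Set ℂ) : ℝ≥0∞ :=
  (1 / 2) * ∫⁻ z in U, ENNReal.ofReal (normSqDifferential E u z)

end JHolomorphic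

end

/-!
A `J`-holomorphic map `u` has energy density `φ = |du|² / 2`, and `φ` satisfies a differential
inequality `Δφ ≥ -A φ²`, where `A` can be chosen uniformly for all `u` with image in a given
compact subset of `X` (`exists_planeLaplacian_energyDensity_ge`). The inequality is local on `X`
and is proved in a chart, without a connection: compatibility gives `φ = g(u_s, u_s)`, and the
Cauchy-Riemann equation `u_t = J u_s` together with `J² = -1` expresses `Δu` and `Δu_s` through
`u_s` and `u_ss` alone. Then `Δφ ≥ 2 g(u_ss, u_ss) - C |u_s|² |u_ss| - C |u_s|⁴`, and completing
the square leaves a multiple of `-|u_s|⁴`.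

For a nonnegative function with `Δφ ≥ -A φ²` on a disk of radius `R` and `∫ φ` small compared with
`1 / A`, Heinz' trick (`heinz_ball`) bounds `φ(0)` by a multiple of `∫ φ / R²`. It rests on the
mean value inequality for functions with Laplacian bounded below (`le_setIntegral_ball`). The
energy threshold is chosen so small that the constant is better than the one claimed. Hence the
inequality is strict as soon as the energy is positive, and a map of zero energy is constant.

The threshold so far depends on a compact set. All balls close to a relatively compact ball lie in
one compact set (`exists_isCompact_eventually_riemannianBall_subset`), so a constant threshold
works near each pair `(x, r)` with relatively compact ball, and a partition of unity produces a
continuous one (`exists_continuousOn_of_local_const`).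
-/

/-! ### Circle averages and the Laplacian -/

open Set Filter Topology in
/-- Differentiation under the integral sign over a compact interval, for continuous data. -/
theorem hasDerivAt_intervalIntegral_of_continuous {F F' : ℝ → ℝ → ℝ} {a b : ℝ}
    (hF : Continuous (Function.uncurry F)) (hF' : Continuous (Function.uncurry F'))
    (h : ∀ ρ θ, HasDerivAt (fun ρ ↦ F ρ θ) (F' ρ θ) ρ) (ρ₀ : ℝ) :
    HasDerivAt (fun ρ ↦ ∫ θ in a..b, F ρ θ) (∫ θ in a..b, F' ρ₀ θ) ρ₀ := by
  obtain ⟨C, hC⟩ := ((isCompact_closedBall ρ₀ 1).prod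
    (isCompact_uIcc (a := a) (b := b))).exists_bound_of_continuousOn hF'.continuousOn
  have hs (ρ : ℝ) : Continuous (F ρ) := hF.comp (by fun_prop : Continuous fun θ ↦ (ρ, θ))
  have hs' (ρ : ℝ) : Continuous (F' ρ) := hF'.comp (by fun_prop : Continuous fun θ ↦ (ρ, θ))
  refine (intervalIntegral.hasDerivAt_integral_of_dominated_loc_of_deriv_le
    (bound := fun _ ↦ C) (F := F) (F' := F') (Metric.closedBall_mem_nhds ρ₀ one_pos)
    (Eventually.of_forall fun ρ ↦ (hs ρ).aestronglyMeasurable) ((hs ρ₀).intervalIntegrable _ _)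
    (hs' ρ₀).aestronglyMeasurable ?_ (by simp) ?_).2
  · exact Eventually.of_forall fun θ hθ ρ hρ ↦ hC (ρ, θ) ⟨hρ, uIoc_subset_uIcc hθ⟩
  · exact Eventually.of_forall fun θ _ ρ _ ↦ h ρ θ

/-- The Euclidean Laplacian `∂²f/∂s² + ∂²f/∂t²` of a real function on `ℂ`, as the trace of the
second Fréchet derivative in the basis `1, i`. -/
noncomputable def planeLaplacian (f : ℂ → ℝ) (z : ℂ) : ℝ :=
  fderiv ℝ (fderiv ℝ f) z 1 1 + fderiv ℝ (fderiv ℝ f) z Complex.I Complex.I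

/-- The unit vector `e^{iθ}`, in the form in which polar coordinates produce it. -/
noncomputable def unitVec (θ : ℝ) : ℂ := Real.cos θ + Real.sin θ * Complex.I

theorem continuous_unitVec : Continuous unitVec := by
  unfold unitVec; fun_prop

theorem norm_unitVec (θ : ℝ) : ‖unitVec θ‖ = 1 := by
  have := Complex.norm_exp_ofReal_mul_I θ
  rwa [Complex.exp_mul_I, ← Complex.ofReal_cos, ← Complex.ofReal_sin] at this

theorem hasDerivAt_unitVec (θ : ℝ) : HasDerivAt unitVec (Complex.I * unitVec θ) θ := by
  have h1 := (Real.hasDerivAt_cos θ).ofReal_comp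
  have h2 := ((Real.hasDerivAt_sin θ).ofReal_comp).mul_const Complex.I
  convert! h1.add h2 using 1
  simp only [unitVec]; push_cast; ring_nf; simp; ring

/-- The trace of a bilinear form on `ℂ = ℝ²` can be computed in any rotated orthonormal frame. -/
theorem bilin_unitVec_add_bilin_I_mul_unitVec (B : ℂ →L[ℝ] ℂ →L[ℝ] ℝ) (θ : ℝ) :
    B (unitVec θ) (unitVec θ) + B (Complex.I * unitVec θ) (Complex.I * unitVec θ) =
      B 1 1 + B Complex.I Complex.I := by
  have h1 : unitVec θ = Real.cos θ • (1 : ℂ) + Real.sin θ • Complex.I := by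
    simp [unitVec]
  have h2 : Complex.I * unitVec θ = -Real.sin θ • (1 : ℂ) + Real.cos θ • Complex.I := by
    simp only [unitVec, Complex.real_smul]; push_cast; ring_nf; simp; ring
  rw [h2, h1]
  simp only [map_add, map_smul, _root_.add_apply, _root_.smul_apply,
    smul_eq_mul]
  linear_combination (B 1 1 + B Complex.I Complex.I) * Real.sin_sq_add_cos_sq θ

section CircleAverages

variable {f : ℂ → ℝ}

theorem hasDerivAt_radial (hf : ContDiff ℝ ∞ f) (z₀ : ℂ) (ρ θ : ℝ) :
    HasDerivAt (fun ρ : ℝ ↦ f (z₀ + ρ * unitVec θ))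
    (fderiv ℝ f (z₀ + ρ * unitVec θ) (unitVec θ)) ρ := by
  have h1 : HasDerivAt (fun ρ : ℝ ↦ z₀ + ρ * unitVec θ) (unitVec θ) ρ := by
    simpa using ((hasDerivAt_id ρ).ofReal_comp.mul_const (unitVec θ)).const_add z₀
  exact ((hf.differentiable (by simp)) _).hasFDerivAt.comp_hasDerivAt ρ h1

theorem hasDerivAt_fderiv_radial (hf : ContDiff ℝ ∞ f) (z₀ : ℂ) (ρ θ : ℝ) :
    HasDerivAt (fun ρ : ℝ ↦ fderiv ℝ f (z₀ + ρ * unitVec θ) (unitVec θ))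
    (fderiv ℝ (fderiv ℝ f) (z₀ + ρ * unitVec θ) (unitVec θ) (unitVec θ)) ρ := by
  have h1 : HasDerivAt (fun ρ : ℝ ↦ z₀ + ρ * unitVec θ) (unitVec θ) ρ := by
    simpa using ((hasDerivAt_id ρ).ofReal_comp.mul_const (unitVec θ)).const_add z₀
  have h2 : Differentiable ℝ (fderiv ℝ f) :=
    (contDiff_infty_iff_fderiv.1 hf).2.differentiable (by simp)
  have h3 := (h2 (z₀ + ρ * unitVec θ)).hasFDerivAt.comp_hasDerivAt ρ h1
  simpa using h3.clm_apply (hasDerivAt_const ρ (unitVec θ))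

theorem hasDerivAt_fderiv_tangential (hf : ContDiff ℝ ∞ f) (z₀ : ℂ) (ρ θ : ℝ) :
    HasDerivAt (fun θ : ℝ ↦ fderiv ℝ f (z₀ + ρ * unitVec θ) (Complex.I * unitVec θ))
    (ρ * fderiv ℝ (fderiv ℝ f) (z₀ + ρ * unitVec θ) (Complex.I * unitVec θ) (Complex.I * unitVec θ)
      - fderiv ℝ f (z₀ + ρ * unitVec θ) (unitVec θ)) θ := by
  have h1 : HasDerivAt (fun θ : ℝ ↦ z₀ + ρ * unitVec θ) (ρ • (Complex.I * unitVec θ)) θ := by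
    rw [Complex.real_smul]
    exact ((hasDerivAt_unitVec θ).const_mul (ρ : ℂ)).const_add z₀
  have h2 : Differentiable ℝ (fderiv ℝ f) :=
    (contDiff_infty_iff_fderiv.1 hf).2.differentiable (by simp)
  have h3 := (h2 (z₀ + ρ * unitVec θ)).hasFDerivAt.comp_hasDerivAt θ h1
  have h4 := h3.clm_apply ((hasDerivAt_unitVec θ).const_mul Complex.I)
  convert! h4 using 1
  rw [← mul_assoc Complex.I Complex.I, Complex.I_mul_I]
  rw [map_smul]
  simp [sub_eq_add_neg]

open Set in
/-- Lower bound for circle averages of a smooth `f` with `Δf ≥ -b` on a disk. With `m ρ` the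
integral of `f` over the circle of radius `ρ`, one has `(ρ m')' = ρ ∫ Δf dθ`; integrating this
twice from `0` gives the bound. -/
theorem le_integral_circle (hf : ContDiff ℝ ∞ f) (z₀ : ℂ) {r b : ℝ}
    (hb : ∀ z ∈ Metric.closedBall z₀ r, -b ≤ planeLaplacian f z)
    {ρ : ℝ} (hρ : 0 ≤ ρ) (hρr : ρ ≤ r) :
    2 * Real.pi * f z₀ - Real.pi * b * ρ ^ 2 / 2 ≤
      ∫ θ in -Real.pi..Real.pi, f (z₀ + ρ * unitVec θ) := by
  have cD : Continuous (fderiv ℝ f) := hf.continuous_fderiv (by simp)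
  have cD2 : Continuous (fderiv ℝ (fderiv ℝ f)) :=
    (contDiff_infty_iff_fderiv.1 hf).2.continuous_fderiv (by simp)
  have cf := hf.continuous
  have cu := continuous_unitVec
  set m : ℝ → ℝ := fun ρ ↦ ∫ θ in -Real.pi..Real.pi, f (z₀ + ρ * unitVec θ) with hm
  set m' : ℝ → ℝ := fun ρ ↦
    ∫ θ in -Real.pi..Real.pi, fderiv ℝ f (z₀ + ρ * unitVec θ) (unitVec θ) with hm'
  have dm (ρ) : HasDerivAt m (m' ρ) ρ := by
    refine hasDerivAt_intervalIntegral_of_continuous (F := fun ρ θ ↦ f (z₀ + ρ * unitVec θ))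
      (F' := fun ρ θ ↦ fderiv ℝ f (z₀ + ρ * unitVec θ) (unitVec θ)) ?_ ?_
      (hasDerivAt_radial hf z₀) ρ
    · unfold Function.uncurry; fun_prop
    · unfold Function.uncurry; fun_prop
  have dm' (ρ : ℝ) : HasDerivAt m' (∫ θ in -Real.pi..Real.pi,
      fderiv ℝ (fderiv ℝ f) (z₀ + ρ * unitVec θ) (unitVec θ) (unitVec θ)) ρ := by
    refine hasDerivAt_intervalIntegral_of_continuous
      (F := fun ρ θ ↦ fderiv ℝ f (z₀ + ρ * unitVec θ) (unitVec θ))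
      (F' := fun ρ θ ↦ fderiv ℝ (fderiv ℝ f) (z₀ + ρ * unitVec θ) (unitVec θ) (unitVec θ)) ?_ ?_
      (hasDerivAt_fderiv_radial hf z₀) ρ
    · unfold Function.uncurry; fun_prop
    · unfold Function.uncurry; fun_prop
  -- the derivative in `θ` of the tangential derivative integrates to zero by periodicity
  have tang (ρ : ℝ) : ∫ θ in -Real.pi..Real.pi, (ρ * fderiv ℝ (fderiv ℝ f) (z₀ + ρ * unitVec θ)
      (Complex.I * unitVec θ) (Complex.I * unitVec θ)
      - fderiv ℝ f (z₀ + ρ * unitVec θ) (unitVec θ)) = 0 := by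
    rw [intervalIntegral.integral_eq_sub_of_hasDerivAt
      (fun θ _ ↦ hasDerivAt_fderiv_tangential hf z₀ ρ θ)
      (Continuous.intervalIntegrable (by fun_prop) _ _)]
    simp [unitVec]
  have key (ρ : ℝ) : m' ρ + ρ * (∫ θ in -Real.pi..Real.pi,
      fderiv ℝ (fderiv ℝ f) (z₀ + ρ * unitVec θ) (unitVec θ) (unitVec θ)) =
      ∫ θ in -Real.pi..Real.pi, ρ * planeLaplacian f (z₀ + ρ * unitVec θ) := by
    rw [← add_zero (_ + _), ← tang ρ, hm', ← intervalIntegral.integral_const_mul,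
      ← intervalIntegral.integral_add, ← intervalIntegral.integral_add]
    · refine intervalIntegral.integral_congr fun θ _ ↦ ?_
      simp only [planeLaplacian]
      rw [← bilin_unitVec_add_bilin_I_mul_unitVec _ θ]
      ring
    all_goals exact Continuous.intervalIntegrable (by fun_prop) _ _
  have lower {ρ : ℝ} (h0 : 0 ≤ ρ) (h1 : ρ ≤ r) : -(2 * Real.pi * b * ρ) ≤
      ∫ θ in -Real.pi..Real.pi, ρ * planeLaplacian f (z₀ + ρ * unitVec θ) := by
    have : ∫ θ in -Real.pi..Real.pi, ρ * (-b) = -(2 * Real.pi * b * ρ) := by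
      rw [intervalIntegral.integral_const]; simp; ring
    rw [← this]
    refine intervalIntegral.integral_mono_on (by linarith [Real.pi_pos]) (by simp)
      (Continuous.intervalIntegrable (by unfold planeLaplacian; fun_prop) _ _) fun θ _ ↦ ?_
    refine mul_le_mul_of_nonneg_left (hb _ ?_) h0
    simp [norm_unitVec, abs_of_nonneg h0, h1]
  have r0 : 0 ≤ r := hρ.trans hρr
  have mono1 : MonotoneOn (fun ρ ↦ ρ * m' ρ + Real.pi * b * ρ ^ 2) (Icc 0 r) := by
    have d (ρ : ℝ) := ((hasDerivAt_id ρ).mul (dm' ρ)).add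
      (((hasDerivAt_id ρ).pow 2).const_mul (Real.pi * b))
    refine monotoneOn_of_deriv_nonneg (convex_Icc _ _)
      (fun ρ _ ↦ (d ρ).continuousAt.continuousWithinAt)
      (fun ρ _ ↦ (d ρ).differentiableAt.differentiableWithinAt) fun ρ h ↦ ?_
    rw [interior_Icc] at h
    have e := (d ρ).deriv
    have k := key ρ
    have l := lower h.1.le h.2.le
    refine le_of_le_of_eq ?_ e.symm
    simp only [id, one_mul, Nat.cast_ofNat, mul_one] at *
    simp
    linarith
  have mono2 : MonotoneOn (fun ρ ↦ m ρ + Real.pi * b * ρ ^ 2 / 2) (Icc 0 r) := by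
    have d (ρ : ℝ) := (dm ρ).add
      ((((hasDerivAt_id ρ).pow 2).const_mul (Real.pi * b)).div_const 2)
    refine monotoneOn_of_deriv_nonneg (convex_Icc _ _)
      (fun ρ _ ↦ (d ρ).continuousAt.continuousWithinAt)
      (fun ρ _ ↦ (d ρ).differentiableAt.differentiableWithinAt) fun ρ h ↦ ?_
    rw [interior_Icc] at h
    have e := (d ρ).deriv
    have l := mono1 (left_mem_Icc.2 r0) ⟨h.1.le, h.2.le⟩ h.1.le
    have l2 : 0 ≤ ρ * (m' ρ + Real.pi * b * ρ) := by
      simp only at l; nlinarith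
    have l3 := nonneg_of_mul_nonneg_right l2 h.1
    refine le_of_le_of_eq ?_ e.symm
    simp
    linarith
  have := mono2 (left_mem_Icc.2 r0) ⟨hρ, hρr⟩ hρ
  have hm0 : m 0 = 2 * Real.pi * f z₀ := by
    simp only [hm, Complex.ofReal_zero, zero_mul, add_zero, intervalIntegral.integral_const,
      smul_eq_mul]
    ring
  simp only [hm0] at this
  change _ ≤ m ρ
  linarith

end CircleAverages

/-! ### Mean value inequalities on disks -/

open Set in
theorem setIntegral_ball_eq_polar {f : ℂ → ℝ} (hf : Continuous f) (z₀ : ℂ) {r : ℝ} (hr : 0 ≤ r) :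
    ∫ z in Metric.ball z₀ r, f z =
      ∫ ρ in (0 : ℝ)..r, ρ * ∫ θ in -Real.pi..Real.pi, f (z₀ + ρ * unitVec θ) := by
  have cu := continuous_unitVec
  have h1 : ∫ z in Metric.ball z₀ r, f z =
      ∫ z, (Metric.ball (0 : ℂ) r).indicator (fun z ↦ f (z₀ + z)) z := by
    rw [← integral_indicator Metric.isOpen_ball.measurableSet, ← integral_add_left_eq_self _ z₀]
    refine integral_congr_ae (Filter.Eventually.of_forall fun z ↦ ?_)
    simp [indicator]
  rw [h1, ← Complex.integral_comp_polarCoord_symm]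
  have h2 : ∀ p ∈ polarCoord.target,
      p.1 • (Metric.ball (0 : ℂ) r).indicator (fun z ↦ f (z₀ + z)) (Complex.polarCoord.symm p) =
      (Ioo 0 r ×ˢ Ioo (-Real.pi) Real.pi).indicator
        (fun p : ℝ × ℝ ↦ p.1 * f (z₀ + p.1 * unitVec p.2)) p := by
    intro p hp
    rw [polarCoord_target] at hp
    have h0 : 0 < p.1 := hp.1
    have e : Complex.polarCoord.symm p = p.1 * unitVec p.2 := Complex.polarCoord_symm_apply p
    have hn : ‖Complex.polarCoord.symm p‖ = p.1 := by
      rw [e, norm_mul, norm_unitVec, mul_one, Complex.norm_real, Real.norm_of_nonneg h0.le]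
    by_cases h : p.1 < r
    · have hp' : p ∈ Ioo 0 r ×ˢ Ioo (-Real.pi) Real.pi := ⟨⟨hp.1, h⟩, hp.2⟩
      have hq : Complex.polarCoord.symm p ∈ Metric.ball (0 : ℂ) r := by
        rwa [mem_ball_zero_iff, hn]
      rw [indicator_of_mem hp', indicator_of_mem hq, e, smul_eq_mul]
    · have hp' : p ∉ Ioo 0 r ×ˢ Ioo (-Real.pi) Real.pi := fun hh ↦ h hh.1.2
      have hq : Complex.polarCoord.symm p ∉ Metric.ball (0 : ℂ) r := by
        rwa [mem_ball_zero_iff, hn]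
      rw [indicator_of_notMem hp', indicator_of_notMem hq, smul_zero]
  rw [setIntegral_congr_fun polarCoord.open_target.measurableSet h2,
    setIntegral_indicator (measurableSet_Ioo.prod measurableSet_Ioo), inter_eq_right.2,
    Measure.volume_eq_prod, setIntegral_prod, intervalIntegral.integral_of_le hr,
    integral_Ioc_eq_integral_Ioo]
  · refine setIntegral_congr_fun measurableSet_Ioo fun ρ _ ↦ ?_
    rw [← intervalIntegral.integral_const_mul,
      intervalIntegral.integral_of_le (by linarith [Real.pi_pos]), integral_Ioc_eq_integral_Ioo]
  · refine IntegrableOn.mono_set (t := Icc 0 r ×ˢ Icc (-Real.pi) Real.pi)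
      (ContinuousOn.integrableOn_compact (isCompact_Icc.prod isCompact_Icc) ?_)
      (prod_mono Ioo_subset_Icc_self Ioo_subset_Icc_self)
    exact Continuous.continuousOn (by fun_prop)
  · rw [polarCoord_target]
    exact prod_mono Ioo_subset_Ioi_self subset_rfl

theorem le_setIntegral_ball_of_contDiff {f : ℂ → ℝ} (hf : ContDiff ℝ ∞ f) (z₀ : ℂ) {r b : ℝ}
    (hr : 0 ≤ r) (hb : ∀ z ∈ Metric.closedBall z₀ r, -b ≤ planeLaplacian f z) :
    Real.pi * r ^ 2 * f z₀ - Real.pi * b * r ^ 4 / 8 ≤ ∫ z in Metric.ball z₀ r, f z := by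
  have cu := continuous_unitVec
  have cf := hf.continuous
  rw [setIntegral_ball_eq_polar hf.continuous z₀ hr]
  have h1 : ∫ ρ in (0 : ℝ)..r, ρ * (2 * Real.pi * f z₀ - Real.pi * b * ρ ^ 2 / 2) =
      Real.pi * r ^ 2 * f z₀ - Real.pi * b * r ^ 4 / 8 := by
    have d (ρ : ℝ) : HasDerivAt (fun ρ ↦ Real.pi * ρ ^ 2 * f z₀ - Real.pi * b * ρ ^ 4 / 8)
        (ρ * (2 * Real.pi * f z₀ - Real.pi * b * ρ ^ 2 / 2)) ρ := by
      have h2 := ((((hasDerivAt_id ρ).pow 2).const_mul Real.pi).mul_const (f z₀)).sub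
        ((((hasDerivAt_id ρ).pow 4).const_mul (Real.pi * b)).div_const 8)
      convert! h2 using 1
      simp
      ring
    rw [intervalIntegral.integral_eq_sub_of_hasDerivAt (fun ρ _ ↦ d ρ)
      (Continuous.intervalIntegrable (by fun_prop) _ _)]
    simp
  rw [← h1]
  refine intervalIntegral.integral_mono_on hr (Continuous.intervalIntegrable (by fun_prop) _ _)
    (Continuous.intervalIntegrable (continuous_id.mul
      (intervalIntegral.continuous_parametric_intervalIntegral_of_continuous' ?_ _ _)) _ _) ?_
  · unfold Function.uncurry; fun_prop
  · intro ρ hρ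
    exact mul_le_mul_of_nonneg_left (le_integral_circle hf z₀ hb hρ.1 hρ.2) hρ.1

theorem planeLaplacian_congr {f g : ℂ → ℝ} {z : ℂ} (h : f =ᶠ[nhds z] g) :
    planeLaplacian f z = planeLaplacian g z := by
  unfold planeLaplacian
  rw [h.fderiv.fderiv_eq]

open Set Topology Filter in
/-- The mean value inequality on a closed disk inside the domain of `f`; a cutoff function reduces
it to functions that are smooth on all of `ℂ`. -/
theorem le_setIntegral_ball {f : ℂ → ℝ} {U : Set ℂ} (hU : IsOpen U) (hf : ContDiffOn ℝ ∞ f U)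
    {z₀ : ℂ} {r b : ℝ} (hr : 0 < r) (hrU : Metric.closedBall z₀ r ⊆ U)
    (hb : ∀ z ∈ Metric.closedBall z₀ r, -b ≤ planeLaplacian f z) :
    Real.pi * r ^ 2 * f z₀ - Real.pi * b * r ^ 4 / 8 ≤ ∫ z in Metric.ball z₀ r, f z := by
  obtain ⟨δ, hδ, hδU⟩ := (isCompact_closedBall z₀ r).exists_cthickening_subset_open hU hrU
  rw [cthickening_closedBall hδ.le hr.le] at hδU
  let χ : ContDiffBump z₀ := ⟨r + δ / 2, r + δ, by positivity, by linarith⟩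
  have hχ : ContDiff ℝ ∞ (fun z ↦ χ z * f z) := by
    rw [contDiff_iff_contDiffAt]
    intro z
    by_cases hz : z ∈ U
    · exact χ.contDiff.contDiffAt.mul (hf.contDiffAt (hU.mem_nhds hz))
    · have : z ∉ tsupport χ := by
        rw [χ.tsupport_eq]
        exact fun h ↦ hz (hδU (by rwa [add_comm δ r]))
      refine contDiffAt_const (c := (0 : ℝ)) |>.congr_of_eventuallyEq ?_
      filter_upwards [notMem_tsupport_iff_eventuallyEq.1 this] with w hw
      simp [hw]
  have heq : ∀ z ∈ Metric.closedBall z₀ r, (fun z ↦ χ z * f z) =ᶠ[𝓝 z] f := by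
    intro z hz
    have : Metric.ball z₀ (r + δ / 2) ∈ 𝓝 z := Metric.isOpen_ball.mem_nhds
      (Metric.closedBall_subset_ball (by linarith) hz)
    filter_upwards [this] with w hw
    rw [χ.one_of_mem_closedBall (Metric.ball_subset_closedBall hw), one_mul]
  have := le_setIntegral_ball_of_contDiff hχ z₀ (b := b) hr.le
    fun z hz ↦ by rw [planeLaplacian_congr (heq z hz)]; exact hb z hz
  rw [(heq z₀ (Metric.mem_closedBall_self hr.le)).eq_of_nhds] at this
  refine this.trans_eq (setIntegral_congr_fun Metric.isOpen_ball.measurableSet fun z hz ↦ ?_)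
  exact (heq z (Metric.ball_subset_closedBall hz)).eq_of_nhds

open Set in
/-- Heinz' trick. The continuous function `(R' - |z|)² f(z)` attains its maximum over the closed
disk of radius `R'` at some `z`; with `c = f z` and `2δ = R' - |z|`, on the disk of radius `δ`
about `z` one has `f ≤ 4c`, hence `Δf ≥ -16Ac²`, and the mean value inequality applies on any
smaller disk. -/
theorem heinz_closedBall {f : ℂ → ℝ} {R R' A e : ℝ} (hR' : 0 < R') (hRR : R' < R)
    (hf : ContDiffOn ℝ ∞ f (Metric.ball 0 R)) (hf0 : ∀ z ∈ Metric.ball 0 R, 0 ≤ f z) (hA : 0 < A)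
    (hΔ : ∀ z ∈ Metric.ball 0 R, -(A * f z ^ 2) ≤ planeLaplacian f z) (he0 : 0 ≤ e)
    (hfe : ∀ z r, 0 < r → Metric.closedBall z r ⊆ Metric.ball 0 R →
      ∫ w in Metric.ball z r, f w ≤ e)
    (he : e < 3 * Real.pi / (32 * A)) :
    f 0 * R' ^ 2 ≤ 16 / 3 * e / Real.pi := by
  have hsub : Metric.closedBall (0 : ℂ) R' ⊆ Metric.ball 0 R := Metric.closedBall_subset_ball hRR
  obtain ⟨z, hz, hmax⟩ := (isCompact_closedBall (0 : ℂ) R').exists_isMaxOn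
    ⟨0, Metric.mem_closedBall_self hR'.le⟩
    (f := fun z ↦ (R' - ‖z‖) ^ 2 * f z)
    (ContinuousOn.mul (by fun_prop) (hf.continuousOn.mono hsub))
  have h0 : f 0 * R' ^ 2 ≤ (R' - ‖z‖) ^ 2 * f z := by
    have := hmax (Metric.mem_closedBall_self hR'.le)
    simp only [mem_ofPred_eq, norm_zero, sub_zero] at this
    linarith
  have hrhs : 0 ≤ 16 / 3 * e / Real.pi := by positivity
  set c := f z with hc
  have hzR : ‖z‖ ≤ R' := by simpa using hz
  have hc0 : 0 ≤ c := hf0 z (hsub hz)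
  rcases hc0.eq_or_lt with hc0 | hc0
  · rw [← hc0, mul_zero] at h0; exact h0.trans hrhs
  rcases hzR.eq_or_lt with hzR | hzR
  · rw [hzR, sub_self] at h0; norm_num at h0; exact h0.trans hrhs
  set δ := (R' - ‖z‖) / 2 with hδ
  have hδ0 : 0 < δ := by rw [hδ]; linarith
  have hball : ∀ w ∈ Metric.closedBall z δ, ‖w‖ ≤ R' ∧ f w ≤ 4 * c := by
    intro w hw
    have h1 : ‖w‖ ≤ ‖z‖ + δ := by
      have := norm_add_le z (w - z)
      rw [Metric.mem_closedBall, dist_eq_norm] at hw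
      rw [add_sub_cancel] at this
      linarith
    have h2 : ‖w‖ ≤ R' := by rw [hδ] at h1; linarith
    refine ⟨h2, ?_⟩
    have h3 : (R' - ‖w‖) ^ 2 * f w ≤ (2 * δ) ^ 2 * c := by
      have := hmax (show w ∈ Metric.closedBall 0 R' by simpa using h2)
      rw [show 2 * δ = R' - ‖z‖ by rw [hδ]; ring]
      exact this
    have h4 : δ ^ 2 ≤ (R' - ‖w‖) ^ 2 := by
      refine pow_le_pow_left₀ hδ0.le ?_ 2
      rw [hδ] at h1 ⊢; linarith
    have h5 : δ ^ 2 * f w ≤ δ ^ 2 * (4 * c) := by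
      have := mul_le_mul_of_nonneg_right h4 (hf0 w (hsub (by simpa using h2)))
      nlinarith
    exact le_of_mul_le_mul_left h5 (by positivity)
  have hmean : ∀ r, 0 < r → r ≤ δ →
      Real.pi * r ^ 2 * c - 2 * Real.pi * A * c ^ 2 * r ^ 4 ≤ e := by
    intro r hr hrδ
    have hs : Metric.closedBall z r ⊆ Metric.ball 0 R := fun w hw ↦
      hsub (by simpa using (hball w (Metric.closedBall_subset_closedBall hrδ hw)).1)
    have := le_setIntegral_ball Metric.isOpen_ball hf hr hs (b := 16 * A * c ^ 2) fun w hw ↦ by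
      refine le_trans ?_ (hΔ w (hs hw))
      have h1 := (hball w (Metric.closedBall_subset_closedBall hrδ hw)).2
      have h2 : f w ^ 2 ≤ (4 * c) ^ 2 := pow_le_pow_left₀ (hf0 w (hs hw)) h1 2
      nlinarith
    have h2 := hfe z r hr hs
    rw [← hc] at this
    linarith
  have hδ2 : (R' - ‖z‖) ^ 2 * c = 4 * (δ ^ 2 * c) := by rw [hδ]; ring
  rw [hδ2] at h0
  refine h0.trans ?_
  rw [le_div_iff₀ Real.pi_pos]
  have hpi := Real.pi_pos
  -- if `8Acδ² ≤ 1`, the radius `δ` gives the estimate; otherwise the radius with `8Acr² = 1` is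
  -- admissible and contradicts the smallness of `e`
  by_cases hcase : 8 * A * c * δ ^ 2 ≤ 1
  · have h1 := hmean δ hδ0 le_rfl
    have h2 : 0 < Real.pi * (δ ^ 2 * c) := by positivity
    nlinarith
  · exfalso
    push Not at hcase
    set r := Real.sqrt (1 / (8 * A * c)) with hr
    have hr2 : r ^ 2 = 1 / (8 * A * c) := Real.sq_sqrt (by positivity)
    have hr0 : 0 < r := Real.sqrt_pos.2 (by positivity)
    have hrδ : r ≤ δ := by
      refine Real.sqrt_le_iff.2 ⟨hδ0.le, ?_⟩
      rw [div_le_iff₀ (by positivity)]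
      linarith
    have h1 := hmean r hr0 hrδ
    rw [show r ^ 4 = (r ^ 2) ^ 2 by ring, hr2] at h1
    have h2 : Real.pi * (1 / (8 * A * c)) * c - 2 * Real.pi * A * c ^ 2 * (1 / (8 * A * c)) ^ 2 =
      3 * Real.pi / (32 * A) := by field_simp; ring
    linarith

/-- The mean value inequality for `Δf ≥ -A f²` on an open disk, under a smallness assumption on
the integral of `f`. The constant `16 / 3` is smaller than the constant `8` needed for the energy
density, which leaves room for strict inequality. -/
theorem heinz_ball {f : ℂ → ℝ} {R A e : ℝ} (hR : 0 < R)
    (hf : ContDiffOn ℝ ∞ f (Metric.ball 0 R)) (hf0 : ∀ z ∈ Metric.ball 0 R, 0 ≤ f z) (hA : 0 < A)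
    (hΔ : ∀ z ∈ Metric.ball 0 R, -(A * f z ^ 2) ≤ planeLaplacian f z) (he0 : 0 ≤ e)
    (hfe : ∀ z r, 0 < r → Metric.closedBall z r ⊆ Metric.ball 0 R →
      ∫ w in Metric.ball z r, f w ≤ e)
    (he : e < 3 * Real.pi / (32 * A)) :
    f 0 * R ^ 2 ≤ 16 / 3 * e / Real.pi := by
  have ht : Filter.Tendsto (fun R' : ℝ ↦ f 0 * R' ^ 2) (nhdsWithin R (Set.Iio R))
      (nhds (f 0 * R ^ 2)) :=
    ((continuous_const.mul (continuous_pow 2)).tendsto R).mono_left nhdsWithin_le_nhds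
  refine le_of_tendsto ht ?_
  filter_upwards [Ioo_mem_nhdsLT hR] with R' hR'
  exact heinz_closedBall hR'.1 hR'.2 hf hf0 hA hΔ he0 hfe he

/-! ### The energy density in a chart -/

section DirDeriv

variable {F F' : Type*} [NormedAddCommGroup F] [NormedSpace ℝ F] [NormedAddCommGroup F']
  [NormedSpace ℝ F'] {U : Set ℂ} {z : ℂ}

/-- The derivative of `f` in the constant direction `h`, as a function on `ℂ`. -/
noncomputable def dirDeriv (h : ℂ) (f : ℂ → F) (z : ℂ) : F := fderiv ℝ f z h

theorem ContDiffOn.dirDeriv {f : ℂ → F} (hU : IsOpen U) (hf : ContDiffOn ℝ ∞ f U) (h : ℂ) :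
    ContDiffOn ℝ ∞ (dirDeriv h f) U :=
  ((contDiffOn_infty_iff_fderiv_of_isOpen hU).1 hf).2.clm_apply contDiffOn_const

theorem ContDiffOn.hasFDerivAt_of_isOpen {E : Type*} [NormedAddCommGroup E] [NormedSpace ℝ E]
    {f : E → F} {U : Set E} {z : E} (hf : ContDiffOn ℝ ∞ f U) (hU : IsOpen U) (hz : z ∈ U) :
    HasFDerivAt f (fderiv ℝ f z) z :=
  ((hf.contDiffAt (hU.mem_nhds hz)).differentiableAt (by simp)).hasFDerivAt

theorem dirDeriv_congr {f g : ℂ → F} (hU : IsOpen U) (hfg : Set.EqOn f g U) (hz : z ∈ U) (h : ℂ) :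
    dirDeriv h f z = dirDeriv h g z := by
  unfold dirDeriv
  rw [(Filter.eventuallyEq_of_mem (hU.mem_nhds hz) hfg).fderiv_eq]

theorem dirDeriv_dirDeriv {f : ℂ → F} (hU : IsOpen U) (hf : ContDiffOn ℝ ∞ f U) (hz : z ∈ U)
    (h k : ℂ) : dirDeriv h (dirDeriv k f) z = fderiv ℝ (fderiv ℝ f) z h k := by
  have := ((contDiffOn_infty_iff_fderiv_of_isOpen hU).1 hf).2.hasFDerivAt_of_isOpen hU hz
  unfold dirDeriv
  rw [(this.clm_apply (hasFDerivAt_const k z)).fderiv]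
  simp

theorem dirDeriv_comm {f : ℂ → F} (hU : IsOpen U) (hf : ContDiffOn ℝ ∞ f U) (hz : z ∈ U)
    (h k : ℂ) : dirDeriv h (dirDeriv k f) z = dirDeriv k (dirDeriv h f) z := by
  rw [dirDeriv_dirDeriv hU hf hz, dirDeriv_dirDeriv hU hf hz]
  exact ((hf.contDiffAt (hU.mem_nhds hz)).isSymmSndFDerivAt (by simp; norm_cast)).eq h k

theorem dirDeriv_clm_apply {A : ℂ → F →L[ℝ] F'} {f : ℂ → F} (hU : IsOpen U)
    (hA : ContDiffOn ℝ ∞ A U) (hf : ContDiffOn ℝ ∞ f U) (hz : z ∈ U) (h : ℂ) :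
    dirDeriv h (fun z ↦ A z (f z)) z = dirDeriv h A z (f z) + A z (dirDeriv h f z) := by
  unfold dirDeriv
  rw [((hA.hasFDerivAt_of_isOpen hU hz).clm_apply (hf.hasFDerivAt_of_isOpen hU hz)).fderiv]
  simp [add_comm]

theorem dirDeriv_add {f g : ℂ → F} (hU : IsOpen U)
    (hf : ContDiffOn ℝ ∞ f U) (hg : ContDiffOn ℝ ∞ g U) (hz : z ∈ U) (h : ℂ) :
    dirDeriv h (fun z ↦ f z + g z) z = dirDeriv h f z + dirDeriv h g z := by
  unfold dirDeriv
  rw [((hf.hasFDerivAt_of_isOpen hU hz).fun_add (hg.hasFDerivAt_of_isOpen hU hz)).fderiv]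
  simp

theorem dirDeriv_comp {E : Type*} [NormedAddCommGroup E] [NormedSpace ℝ E] {V : Set E}
    {A : E → F} {v : ℂ → E} (hU : IsOpen U) (hV : IsOpen V) (hA : ContDiffOn ℝ ∞ A V)
    (hv : ContDiffOn ℝ ∞ v U) (hm : Set.MapsTo v U V) (hz : z ∈ U) (h : ℂ) :
    dirDeriv h (fun z ↦ A (v z)) z = fderiv ℝ A (v z) (dirDeriv h v z) := by
  unfold dirDeriv
  have := (hA.hasFDerivAt_of_isOpen hV (hm hz)).comp z (hv.hasFDerivAt_of_isOpen hU hz)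
  change fderiv ℝ (A ∘ v) z h = _
  rw [this.fderiv]
  rfl

end DirDeriv

/-- Completing the square in `p`. -/
theorem quartic_le_of_bounds {m M a p φ : ℝ} (hm : 0 < m) (hM : 1 ≤ M) (hφ : m * a ^ 2 ≤ φ) :
    -((50 * M ^ 6 / m + 16 * M ^ 3) / m ^ 2 * φ ^ 2) ≤
      2 * m * p ^ 2 - 20 * M ^ 3 * (a ^ 2 * p) - 16 * M ^ 3 * a ^ 4 := by
  have h1 : (m * a ^ 2) ^ 2 ≤ φ ^ 2 := pow_le_pow_left₀ (by positivity) hφ 2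
  have h2 : (50 * M ^ 6 / m + 16 * M ^ 3) / m ^ 2 * (m * a ^ 2) ^ 2 ≤
      (50 * M ^ 6 / m + 16 * M ^ 3) / m ^ 2 * φ ^ 2 :=
    mul_le_mul_of_nonneg_left h1 (by positivity)
  have h3 : (50 * M ^ 6 / m + 16 * M ^ 3) / m ^ 2 * (m * a ^ 2) ^ 2 =
      (50 * M ^ 6 / m + 16 * M ^ 3) * a ^ 4 := by field_simp
  have h4 : 0 ≤ 2 * m * (p - 5 * M ^ 3 * a ^ 2 / m) ^ 2 := by positivity
  have h5 : 2 * m * (p - 5 * M ^ 3 * a ^ 2 / m) ^ 2 =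
      2 * m * p ^ 2 - 20 * M ^ 3 * (a ^ 2 * p) + 50 * M ^ 6 / m * a ^ 4 := by field_simp; ring
  linarith

section LocalEstimate

set_option maxSynthPendingDepth 3

variable {E : Type*} [NormedAddCommGroup E] [NormedSpace ℝ E] {V : Set E} {U : Set ℂ}
  {G : E → E →L[ℝ] E →L[ℝ] ℝ} {J : E → E →L[ℝ] E} {v : ℂ → E} {z : ℂ}

/-- The function `G(v)(∂ₛv, ∂ₛv)` on `ℂ`, for a field `G` of bilinear forms on `E` and
`v : ℂ → E`. -/
noncomputable def localDensity (G : E → E →L[ℝ] E →L[ℝ] ℝ) (v : ℂ → E) (z : ℂ) : ℝ :=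
  G (v z) (dirDeriv 1 v z) (dirDeriv 1 v z)

theorem ContDiffOn.localDensity (hU : IsOpen U)
    (hG : ContDiffOn ℝ ∞ G V) (hv : ContDiffOn ℝ ∞ v U) (hm : Set.MapsTo v U V) :
    ContDiffOn ℝ ∞ (localDensity G v) U :=
  ((hG.comp hv hm).clm_apply (hv.dirDeriv hU 1)).clm_apply (hv.dirDeriv hU 1)

theorem dirDeriv_localDensity (hV : IsOpen V) (hU : IsOpen U)
    (hG : ContDiffOn ℝ ∞ G V) (hv : ContDiffOn ℝ ∞ v U) (hm : Set.MapsTo v U V)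
    (hz : z ∈ U) (h : ℂ) :
    dirDeriv h (localDensity G v) z =
      fderiv ℝ G (v z) (dirDeriv h v z) (dirDeriv 1 v z) (dirDeriv 1 v z) +
      G (v z) (dirDeriv h (dirDeriv 1 v) z) (dirDeriv 1 v z) +
      G (v z) (dirDeriv 1 v z) (dirDeriv h (dirDeriv 1 v) z) := by
  have cG : ContDiffOn ℝ ∞ (fun z ↦ G (v z)) U := hG.comp hv hm
  have cv1 (h : ℂ) := hv.dirDeriv hU h
  unfold localDensity
  rw [dirDeriv_clm_apply hU (cG.clm_apply (cv1 1)) (cv1 1) hz,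
    dirDeriv_clm_apply hU cG (cv1 1) hz, dirDeriv_comp hU hV hG hv hm hz]
  simp only [_root_.add_apply]

theorem dirDeriv_dirDeriv_localDensity (hV : IsOpen V) (hU : IsOpen U)
    (hG : ContDiffOn ℝ ∞ G V) (hv : ContDiffOn ℝ ∞ v U) (hm : Set.MapsTo v U V)
    (hz : z ∈ U) (h : ℂ) :
    dirDeriv h (dirDeriv h (localDensity G v)) z =
      fderiv ℝ (fderiv ℝ G) (v z) (dirDeriv h v z) (dirDeriv h v z) (dirDeriv 1 v z)
        (dirDeriv 1 v z) +
      fderiv ℝ G (v z) (dirDeriv h (dirDeriv h v) z) (dirDeriv 1 v z) (dirDeriv 1 v z) +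
      2 * fderiv ℝ G (v z) (dirDeriv h v z) (dirDeriv h (dirDeriv 1 v) z) (dirDeriv 1 v z) +
      2 * fderiv ℝ G (v z) (dirDeriv h v z) (dirDeriv 1 v z) (dirDeriv h (dirDeriv 1 v) z) +
      G (v z) (dirDeriv h (dirDeriv h (dirDeriv 1 v)) z) (dirDeriv 1 v z) +
      G (v z) (dirDeriv 1 v z) (dirDeriv h (dirDeriv h (dirDeriv 1 v)) z) +
      2 * G (v z) (dirDeriv h (dirDeriv 1 v) z) (dirDeriv h (dirDeriv 1 v) z) := by
  have hG1 := ((contDiffOn_infty_iff_fderiv_of_isOpen hV).1 hG).2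
  have cG : ContDiffOn ℝ ∞ (fun z ↦ G (v z)) U := hG.comp hv hm
  have cG1 : ContDiffOn ℝ ∞ (fun z ↦ fderiv ℝ G (v z)) U := hG1.comp hv hm
  have cv1 (h : ℂ) := hv.dirDeriv hU h
  have cv2 (h k : ℂ) := (hv.dirDeriv hU h).dirDeriv hU k
  have c1 := cG1.clm_apply (cv1 h)
  have c2 := c1.clm_apply (cv1 1)
  have c3 := cG.clm_apply (cv2 1 h)
  have c4 := cG.clm_apply (cv1 1)
  rw [dirDeriv_congr hU (fun ζ hζ ↦ dirDeriv_localDensity hV hU hG hv hm hζ h) hz,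
    dirDeriv_add hU ((c2.clm_apply (cv1 1)).add
    (c3.clm_apply (cv1 1))) (c4.clm_apply (cv2 1 h)) hz,
    dirDeriv_add hU (c2.clm_apply (cv1 1)) (c3.clm_apply (cv1 1)) hz,
    dirDeriv_clm_apply hU c2 (cv1 1) hz, dirDeriv_clm_apply hU c1 (cv1 1) hz,
    dirDeriv_clm_apply hU cG1 (cv1 h) hz, dirDeriv_clm_apply hU c3 (cv1 1) hz,
    dirDeriv_clm_apply hU cG (cv2 1 h) hz, dirDeriv_clm_apply hU c4 (cv2 1 h) hz,
    dirDeriv_clm_apply hU cG (cv1 1) hz,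
    dirDeriv_comp hU hV hG hv hm hz, dirDeriv_comp hU hV hG1 hv hm hz]
  simp only [_root_.add_apply]
  ring

section CauchyRiemann

variable (hV : IsOpen V) (hU : IsOpen U) (hJ : ContDiffOn ℝ ∞ J V) (hv : ContDiffOn ℝ ∞ v U)
  (hm : Set.MapsTo v U V)
  (hhol : ∀ z ∈ U, dirDeriv Complex.I v z = J (v z) (dirDeriv 1 v z)) (hz : z ∈ U)
include hV hU hJ hv hm hhol hz

/-- The mixed second derivative, by differentiating the Cauchy-Riemann equation along `s`. -/
theorem dirDeriv_I_dirDeriv_one : dirDeriv Complex.I (dirDeriv 1 v) z =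
    fderiv ℝ J (v z) (dirDeriv 1 v z) (dirDeriv 1 v z) +
      J (v z) (dirDeriv 1 (dirDeriv 1 v) z) := by
  rw [dirDeriv_comm hU hv hz, dirDeriv_congr hU hhol hz,
    dirDeriv_clm_apply (A := fun z ↦ J (v z)) hU (hJ.comp hv hm)
      (hv.dirDeriv hU 1) hz, dirDeriv_comp hU hV hJ hv hm hz]

/-- The second derivative in `t`, by differentiating the Cauchy-Riemann equation along `t`. -/
theorem dirDeriv_I_dirDeriv_I : dirDeriv Complex.I (dirDeriv Complex.I v) z =
    fderiv ℝ J (v z) (dirDeriv Complex.I v z) (dirDeriv 1 v z) +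
      J (v z) (dirDeriv Complex.I (dirDeriv 1 v) z) := by
  rw [dirDeriv_congr hU hhol hz, dirDeriv_clm_apply (A := fun z ↦ J (v z)) hU (hJ.comp hv hm)
    (hv.dirDeriv hU 1) hz, dirDeriv_comp hU hV hJ hv hm hz]

theorem dirDeriv_dirDeriv_I_dirDeriv_one (h : ℂ) :
    dirDeriv h (dirDeriv Complex.I (dirDeriv 1 v)) z =
      fderiv ℝ (fderiv ℝ J) (v z) (dirDeriv h v z) (dirDeriv 1 v z) (dirDeriv 1 v z) +
      fderiv ℝ J (v z) (dirDeriv h (dirDeriv 1 v) z) (dirDeriv 1 v z) +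
      fderiv ℝ J (v z) (dirDeriv 1 v z) (dirDeriv h (dirDeriv 1 v) z) +
      fderiv ℝ J (v z) (dirDeriv h v z) (dirDeriv 1 (dirDeriv 1 v) z) +
      J (v z) (dirDeriv h (dirDeriv 1 (dirDeriv 1 v)) z) := by
  have hJ1 := ((contDiffOn_infty_iff_fderiv_of_isOpen hV).1 hJ).2
  have cJ : ContDiffOn ℝ ∞ (fun z ↦ J (v z)) U := hJ.comp hv hm
  have cJ1 : ContDiffOn ℝ ∞ (fun z ↦ fderiv ℝ J (v z)) U := hJ1.comp hv hm
  have cv1 (h : ℂ) := hv.dirDeriv hU h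
  have cv2 (h k : ℂ) := (hv.dirDeriv hU h).dirDeriv hU k
  have c1 := cJ1.clm_apply (cv1 1)
  rw [dirDeriv_congr hU (fun ζ hζ ↦ dirDeriv_I_dirDeriv_one hV hU hJ hv hm hhol hζ) hz,
    dirDeriv_add hU (c1.clm_apply (cv1 1))
    (cJ.clm_apply (cv2 1 1)) hz, dirDeriv_clm_apply hU c1 (cv1 1) hz,
    dirDeriv_clm_apply hU cJ1 (cv1 1) hz, dirDeriv_clm_apply hU cJ (cv2 1 1) hz,
    dirDeriv_comp hU hV hJ hv hm hz, dirDeriv_comp hU hV hJ1 hv hm hz]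
  simp only [_root_.add_apply, add_assoc]

end CauchyRiemann

/-- The field of endomorphisms `J` and the field of bilinear forms `G` have derivatives up to second
order bounded by `M` at the point `y`, and `G y` is bounded below by `m`. The bounds are stated on
vectors rather than as operator norms. -/
structure JetBounds (G : E → E →L[ℝ] E →L[ℝ] ℝ) (J : E → E →L[ℝ] E) (M m : ℝ) (y : E) : Prop where
  J0 : ∀ a, ‖J y a‖ ≤ M * ‖a‖
  J1 : ∀ a b, ‖fderiv ℝ J y a b‖ ≤ M * ‖a‖ * ‖b‖
  J2 : ∀ a b c, ‖fderiv ℝ (fderiv ℝ J) y a b c‖ ≤ M * ‖a‖ * ‖b‖ * ‖c‖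
  G0 : ∀ a b, |G y a b| ≤ M * ‖a‖ * ‖b‖
  G1 : ∀ a b c, |fderiv ℝ G y a b c| ≤ M * ‖a‖ * ‖b‖ * ‖c‖
  G2 : ∀ a b c d, |fderiv ℝ (fderiv ℝ G) y a b c d| ≤ M * ‖a‖ * ‖b‖ * ‖c‖ * ‖d‖
  coercive : ∀ a, m * ‖a‖ ^ 2 ≤ G y a a

/-- The differential inequality for the energy density `φ` of a `J`-holomorphic curve `v` in a
chart. In `Δφ` the third derivatives of `v` enter only through `Δ(∂ₛv)`; as `v_t = J(v) v_s`, both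
`Δv` and `Δ(∂ₛv)` are controlled by `|v_s|` and `|v_ss|`. The good term `2m|v_ss|²` absorbs the
terms that are linear in `v_ss`. -/
theorem planeLaplacian_localDensity_ge (hV : IsOpen V) (hU : IsOpen U)
    (hG : ContDiffOn ℝ ∞ G V) (hJ : ContDiffOn ℝ ∞ J V) (hv : ContDiffOn ℝ ∞ v U)
    (hm : Set.MapsTo v U V) (hJ2 : ∀ y ∈ V, ∀ a, J y (J y a) = -a)
    (hhol : ∀ z ∈ U, dirDeriv Complex.I v z = J (v z) (dirDeriv 1 v z))
    (hz : z ∈ U) {M m : ℝ} (hM : 1 ≤ M) (hm0 : 0 < m) (hb : JetBounds G J M m (v z)) :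
    -((50 * M ^ 6 / m + 16 * M ^ 3) / m ^ 2 * localDensity G v z ^ 2) ≤
      planeLaplacian (localDensity G v) z := by
  have hvt := hhol z hz
  have hwt := dirDeriv_I_dirDeriv_one hV hU hJ hv hm hhol hz
  have hvtt := dirDeriv_I_dirDeriv_I hV hU hJ hv hm hhol hz
  have hwtt := dirDeriv_dirDeriv_I_dirDeriv_one hV hU hJ hv hm hhol hz Complex.I
  have hpt := dirDeriv_dirDeriv_I_dirDeriv_one hV hU hJ hv hm hhol hz 1
  have hsym : dirDeriv Complex.I (dirDeriv 1 (dirDeriv 1 v)) z =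
    dirDeriv 1 (dirDeriv Complex.I (dirDeriv 1 v)) z := dirDeriv_comm hU (hv.dirDeriv hU 1) hz _ _
  have cφ := hG.localDensity hU hv hm
  rw [hsym] at hwtt
  unfold planeLaplacian
  rw [← dirDeriv_dirDeriv hU cφ hz, ← dirDeriv_dirDeriv hU cφ hz,
    dirDeriv_dirDeriv_localDensity hV hU hG hv hm hz,
    dirDeriv_dirDeriv_localDensity hV hU hG hv hm hz]
  unfold localDensity
  have hJJ := hJ2 _ (hm hz)
  generalize dirDeriv 1 (dirDeriv Complex.I (dirDeriv 1 v)) z = pt at *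
  generalize dirDeriv Complex.I (dirDeriv Complex.I (dirDeriv 1 v)) z = wtt at *
  generalize dirDeriv 1 (dirDeriv 1 (dirDeriv 1 v)) z = ps at *
  generalize dirDeriv Complex.I (dirDeriv Complex.I v) z = vtt at *
  generalize dirDeriv Complex.I (dirDeriv 1 v) z = wt at *
  generalize dirDeriv 1 (dirDeriv 1 v) z = p at *
  generalize dirDeriv Complex.I v z = vt at *
  generalize dirDeriv 1 v z = w at *
  obtain ⟨bJ0, bJ1, bJ2, bG0, bG1, bG2, bGm⟩ := hb
  have M0 : 0 ≤ M := zero_le_one.trans hM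
  have a0 : 0 ≤ ‖w‖ := norm_nonneg _
  have q0 : 0 ≤ ‖p‖ := norm_nonneg _
  -- the sum of the pure second derivatives of `v` is quadratic in `w`
  have e1 : p + vtt = fderiv ℝ J (v z) vt w + J (v z) (fderiv ℝ J (v z) w w) := by
    rw [hvtt, hwt, map_add, hJJ]; abel
  -- in the Laplacian of `w` the third derivatives cancel, because `J² = -1`
  have e2 : ps + wtt = fderiv ℝ (fderiv ℝ J) (v z) vt w w + fderiv ℝ J (v z) wt w +
      fderiv ℝ J (v z) w wt + fderiv ℝ J (v z) vt p +
      J (v z) (fderiv ℝ (fderiv ℝ J) (v z) w w w + fderiv ℝ J (v z) p w +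
      fderiv ℝ J (v z) w p + fderiv ℝ J (v z) w p) := by
    rw [hwtt, hpt, map_add _ _ (J (v z) ps), hJJ]; abel
  have nvt : ‖vt‖ ≤ M * ‖w‖ := hvt ▸ bJ0 w
  have nwt : ‖wt‖ ≤ M * (‖w‖ ^ 2 + ‖p‖) := by
    rw [hwt]
    calc _ ≤ M * ‖w‖ * ‖w‖ + M * ‖p‖ := norm_add_le_of_le (bJ1 _ _) (bJ0 _)
      _ = _ := by ring
  have nlv : ‖p + vtt‖ ≤ 2 * M ^ 2 * ‖w‖ ^ 2 := by
    rw [e1]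
    calc _ ≤ M * ‖vt‖ * ‖w‖ + M * (M * ‖w‖ * ‖w‖) := norm_add_le_of_le (bJ1 _ _)
          ((bJ0 _).trans (mul_le_mul_of_nonneg_left (bJ1 _ _) M0))
      _ ≤ M * (M * ‖w‖) * ‖w‖ + M * (M * ‖w‖ * ‖w‖) := by gcongr
      _ = _ := by ring
  have nlw : ‖ps + wtt‖ ≤ 4 * M ^ 2 * ‖w‖ ^ 3 + 6 * M ^ 2 * (‖w‖ * ‖p‖) := by
    rw [e2]
    calc _ ≤ M * ‖vt‖ * ‖w‖ * ‖w‖ + M * ‖wt‖ * ‖w‖ + M * ‖w‖ * ‖wt‖ + M * ‖vt‖ * ‖p‖ +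
          M * (M * ‖w‖ * ‖w‖ * ‖w‖ + M * ‖p‖ * ‖w‖ + M * ‖w‖ * ‖p‖ + M * ‖w‖ * ‖p‖) := by
          refine norm_add_le_of_le (norm_add_le_of_le (norm_add_le_of_le (norm_add_le_of_le
            (bJ2 _ _ _) (bJ1 _ _)) (bJ1 _ _)) (bJ1 _ _)) ((bJ0 _).trans
            (mul_le_mul_of_nonneg_left ?_ M0))
          exact norm_add_le_of_le (norm_add_le_of_le (norm_add_le_of_le
            (bJ2 _ _ _) (bJ1 _ _)) (bJ1 _ _)) (bJ1 _ _)
      _ ≤ M * (M * ‖w‖) * ‖w‖ * ‖w‖ + M * (M * (‖w‖ ^ 2 + ‖p‖)) * ‖w‖ +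
          M * ‖w‖ * (M * (‖w‖ ^ 2 + ‖p‖)) + M * (M * ‖w‖) * ‖p‖ +
          M * (M * ‖w‖ * ‖w‖ * ‖w‖ + M * ‖p‖ * ‖w‖ + M * ‖w‖ * ‖p‖ + M * ‖w‖ * ‖p‖) := by
          gcongr
      _ = _ := by ring
  have b1 : |fderiv ℝ (fderiv ℝ G) (v z) w w w w| ≤ M * ‖w‖ ^ 4 :=
    (bG2 _ _ _ _).trans_eq (by ring)
  have b2 : |fderiv ℝ (fderiv ℝ G) (v z) vt vt w w| ≤ M ^ 3 * ‖w‖ ^ 4 := by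
    calc _ ≤ M * ‖vt‖ * ‖vt‖ * ‖w‖ * ‖w‖ := bG2 _ _ _ _
      _ ≤ M * (M * ‖w‖) * (M * ‖w‖) * ‖w‖ * ‖w‖ := by gcongr
      _ = _ := by ring
  have b3 : |fderiv ℝ G (v z) (p + vtt) w w| ≤ 2 * M ^ 3 * ‖w‖ ^ 4 := by
    calc _ ≤ M * ‖p + vtt‖ * ‖w‖ * ‖w‖ := bG1 _ _ _
      _ ≤ M * (2 * M ^ 2 * ‖w‖ ^ 2) * ‖w‖ * ‖w‖ := by gcongr
      _ = _ := by ring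
  have b4 : |fderiv ℝ G (v z) w p w| ≤ M * (‖w‖ ^ 2 * ‖p‖) := (bG1 _ _ _).trans_eq (by ring)
  have b5 : |fderiv ℝ G (v z) w w p| ≤ M * (‖w‖ ^ 2 * ‖p‖) := (bG1 _ _ _).trans_eq (by ring)
  have b6 : |fderiv ℝ G (v z) vt wt w| ≤ M ^ 3 * ‖w‖ ^ 4 + M ^ 3 * (‖w‖ ^ 2 * ‖p‖) := by
    calc _ ≤ M * ‖vt‖ * ‖wt‖ * ‖w‖ := bG1 _ _ _
      _ ≤ M * (M * ‖w‖) * (M * (‖w‖ ^ 2 + ‖p‖)) * ‖w‖ := by gcongr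
      _ = _ := by ring
  have b7 : |fderiv ℝ G (v z) vt w wt| ≤ M ^ 3 * ‖w‖ ^ 4 + M ^ 3 * (‖w‖ ^ 2 * ‖p‖) := by
    calc _ ≤ M * ‖vt‖ * ‖w‖ * ‖wt‖ := bG1 _ _ _
      _ ≤ M * (M * ‖w‖) * ‖w‖ * (M * (‖w‖ ^ 2 + ‖p‖)) := by gcongr
      _ = _ := by ring
  have b8 : |G (v z) (ps + wtt) w| ≤ 4 * M ^ 3 * ‖w‖ ^ 4 + 6 * M ^ 3 * (‖w‖ ^ 2 * ‖p‖) := by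
    calc _ ≤ M * ‖ps + wtt‖ * ‖w‖ := bG0 _ _
      _ ≤ M * (4 * M ^ 2 * ‖w‖ ^ 3 + 6 * M ^ 2 * (‖w‖ * ‖p‖)) * ‖w‖ := by gcongr
      _ = _ := by ring
  have b9 : |G (v z) w (ps + wtt)| ≤ 4 * M ^ 3 * ‖w‖ ^ 4 + 6 * M ^ 3 * (‖w‖ ^ 2 * ‖p‖) := by
    calc _ ≤ M * ‖w‖ * ‖ps + wtt‖ := bG0 _ _
      _ ≤ M * ‖w‖ * (4 * M ^ 2 * ‖w‖ ^ 3 + 6 * M ^ 2 * (‖w‖ * ‖p‖)) := by gcongr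
      _ = _ := by ring
  have s3 : fderiv ℝ G (v z) (p + vtt) w w =
      fderiv ℝ G (v z) p w w + fderiv ℝ G (v z) vtt w w := by
    rw [map_add, _root_.add_apply, _root_.add_apply]
  have s8 : G (v z) (ps + wtt) w = G (v z) ps w + G (v z) wtt w := by
    rw [map_add, _root_.add_apply]
  have s9 : G (v z) w (ps + wtt) = G (v z) w ps + G (v z) w wtt := map_add _ _ _
  rw [s3] at b3
  rw [s8] at b8
  rw [s9] at b9
  have c1 := bGm p
  have c2 : 0 ≤ G (v z) wt wt := le_trans (by positivity) (bGm wt)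
  refine (quartic_le_of_bounds (p := ‖p‖) hm0 hM (bGm w)).trans ?_
  have M3 : M ≤ M ^ 3 := le_self_pow₀ hM (by norm_num)
  have d1 : M * ‖w‖ ^ 4 ≤ M ^ 3 * ‖w‖ ^ 4 := by gcongr
  have d2 : M * (‖w‖ ^ 2 * ‖p‖) ≤ M ^ 3 * (‖w‖ ^ 2 * ‖p‖) := by gcongr
  rw [abs_le] at b1 b2 b3 b4 b5 b6 b7 b8 b9
  linarith [b1.1, b2.1, b3.1, b4.1, b5.1, b6.1, b7.1, b8.1, b9.1]

end LocalEstimate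

/-! ### From the manifold to charts -/

section ChartExpressions

variable {E : Type*} [NormedAddCommGroup E] [NormedSpace ℝ E]
  {X : Type*} [TopologicalSpace X] [ChartedSpace E X] [IsManifold 𝓘(ℝ, E) ∞ X]

/-- The frame of `TX` induced by the chart at `x₀`, as a map from the model space to the
tangent space at `y`. It is an isomorphism for `y` in the chart domain and zero elsewhere. -/
noncomputable def chartFrame (x₀ y : X) : E →L[ℝ] TangentSpace 𝓘(ℝ, E) y :=
  (trivializationAt E (TangentSpace 𝓘(ℝ, E) : X → Type _) x₀).symmL ℝ y

/-- The components of a tangent vector at `y` in the frame induced by the chart at `x₀`; zero for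
`y` outside the chart domain. -/
noncomputable def chartCoframe (x₀ y : X) : TangentSpace 𝓘(ℝ, E) y →L[ℝ] E :=
  (trivializationAt E (TangentSpace 𝓘(ℝ, E) : X → Type _) x₀).continuousLinearMapAt ℝ y

variable {x₀ y : X}

theorem chartFrame_chartCoframe (hy : y ∈ (chartAt E x₀).source) (a : TangentSpace 𝓘(ℝ, E) y) :
    chartFrame x₀ y (chartCoframe x₀ y a) = a :=
  (trivializationAt E (TangentSpace 𝓘(ℝ, E) : X → Type _) x₀).symmL_continuousLinearMapAt
    (by rwa [TangentBundle.trivializationAt_baseSet]) a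

theorem chartCoframe_chartFrame (hy : y ∈ (chartAt E x₀).source) (a : E) :
    chartCoframe x₀ y (chartFrame x₀ y a) = a :=
  (trivializationAt E (TangentSpace 𝓘(ℝ, E) : X → Type _) x₀).continuousLinearMapAt_symmL
    (by rwa [TangentBundle.trivializationAt_baseSet]) a

theorem contMDiffOn_chartFrame (x₀ : X) (a : E) :
    ContMDiffOn 𝓘(ℝ, E) (𝓘(ℝ, E).prod 𝓘(ℝ, E)) ∞
      (fun η ↦ TotalSpace.mk' E ((extChartAt 𝓘(ℝ, E) x₀).symm η)
        (chartFrame x₀ ((extChartAt 𝓘(ℝ, E) x₀).symm η) a) :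
        E → TotalSpace E (TangentSpace 𝓘(ℝ, E) : X → Type _)) (extChartAt 𝓘(ℝ, E) x₀).target := by
  set T := trivializationAt E (TangentSpace 𝓘(ℝ, E) : X → Type _) x₀ with hT
  have h1 := T.contMDiffOn_symm (IB := 𝓘(ℝ, E)) (n := ∞)
  have h2 : ContMDiffOn 𝓘(ℝ, E) (𝓘(ℝ, E).prod 𝓘(ℝ, E)) ∞
      (fun η ↦ ((extChartAt 𝓘(ℝ, E) x₀).symm η, a)) (extChartAt 𝓘(ℝ, E) x₀).target :=
    (contMDiffOn_extChartAt_symm x₀).prodMk contMDiffOn_const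
  have hs : ∀ η ∈ (extChartAt 𝓘(ℝ, E) x₀).target,
      (extChartAt 𝓘(ℝ, E) x₀).symm η ∈ T.baseSet := fun η hη ↦ by
    have := (extChartAt 𝓘(ℝ, E) x₀).map_target hη
    rwa [extChartAt_source] at this
  refine (h1.comp h2 fun η hη ↦ T.mem_target.2 (hs η hη)).congr fun η hη ↦ ?_
  rw [Function.comp_apply, ← T.mk_symm (hs η hη)]
  rw [chartFrame, T.symmL_apply (hs η hη)]

/-- The expression of an almost complex structure in the chart at `x₀`, a field of endomorphisms of
the model space that is meaningful on the target of the chart. -/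
noncomputable def AlmostComplexStructure.inChart (J : AlmostComplexStructure E X) (x₀ : X) (η : E) :
    E →L[ℝ] E :=
  chartCoframe x₀ ((extChartAt 𝓘(ℝ, E) x₀).symm η) ∘L
    J.toFun ((extChartAt 𝓘(ℝ, E) x₀).symm η) ∘L chartFrame x₀ ((extChartAt 𝓘(ℝ, E) x₀).symm η)

theorem AlmostComplexStructure.contDiffOn_inChart [FiniteDimensional ℝ E]
    (J : AlmostComplexStructure E X) (x₀ : X) :
    ContDiffOn ℝ ∞ (J.inChart x₀) (extChartAt 𝓘(ℝ, E) x₀).target := by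
  set T := trivializationAt E (TangentSpace 𝓘(ℝ, E) : X → Type _) x₀ with hT
  have hs : ∀ η ∈ (extChartAt 𝓘(ℝ, E) x₀).target,
      (extChartAt 𝓘(ℝ, E) x₀).symm η ∈ T.baseSet := fun η hη ↦ by
    have := (extChartAt 𝓘(ℝ, E) x₀).map_target hη
    rwa [extChartAt_source] at this
  rw [contDiffOn_clm_apply]
  intro a
  rw [← contMDiffOn_iff_contDiffOn]
  have h1 := ContMDiffOn.clm_bundle_apply
    (J.smooth.comp_contMDiffOn (contMDiffOn_extChartAt_symm (I := 𝓘(ℝ, E)) (n := ∞) x₀))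
    (contMDiffOn_chartFrame x₀ a)
  rw [T.contMDiffOn_iff (fun η hη ↦ T.mem_source.2 (hs η hη))] at h1
  refine h1.2.congr fun η hη ↦ ?_
  exact T.continuousLinearMapAt_apply_of_mem ℝ (hs η hη) _

theorem AlmostComplexStructure.inChart_sq (J : AlmostComplexStructure E X) (x₀ : X) {η : E}
    (hη : η ∈ (extChartAt 𝓘(ℝ, E) x₀).target) (a : E) :
    J.inChart x₀ η (J.inChart x₀ η a) = -a := by
  have hs : (extChartAt 𝓘(ℝ, E) x₀).symm η ∈ (chartAt E x₀).source := by
    have := (extChartAt 𝓘(ℝ, E) x₀).map_target hη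
    rwa [extChartAt_source] at this
  simp only [inChart, ContinuousLinearMap.comp_apply]
  rw [chartFrame_chartCoframe hs, J.sq_eq_neg, map_neg, chartCoframe_chartFrame hs]

theorem fderiv_extChartAt_comp {u : ℂ → X} {z : ℂ} (hu : MDifferentiableAt 𝓘(ℝ, ℂ) 𝓘(ℝ, E) u z)
    (hz : u z ∈ (chartAt E x₀).source) (h : ℂ) :
    fderiv ℝ (extChartAt 𝓘(ℝ, E) x₀ ∘ u) z h =
      chartCoframe x₀ (u z) (mfderiv 𝓘(ℝ, ℂ) 𝓘(ℝ, E) u z h) := by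
  rw [← mfderiv_eq_fderiv, mfderiv_comp z
    (mdifferentiableAt_extChartAt hz) hu, chartCoframe,
    TangentBundle.continuousLinearMapAt_trivializationAt hz]
  rfl

end ChartExpressions

section Metric

variable {E : Type*} [NormedAddCommGroup E] [NormedSpace ℝ E]
  {X : Type*} [TopologicalSpace X] [ChartedSpace E X] [IsManifold 𝓘(ℝ, E) ∞ X]
  [RiemannianBundle (fun x : X ↦ TangentSpace 𝓘(ℝ, E) x)]

variable (E X) in
theorem isContinuousRiemannianBundle_tangentSpace
    [IsContMDiffRiemannianBundle 𝓘(ℝ, E) ∞ E (fun x : X ↦ TangentSpace 𝓘(ℝ, E) x)] :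
    IsContinuousRiemannianBundle E (fun x : X ↦ TangentSpace 𝓘(ℝ, E) x) := by
  obtain ⟨g, hg, hg'⟩ := IsContMDiffRiemannianBundle.exists_contMDiff (IB := 𝓘(ℝ, E)) (n := ∞)
    (F := E) (E := fun x : X ↦ TangentSpace 𝓘(ℝ, E) x)
  exact ⟨g, hg.continuous, hg'⟩

variable [FiniteDimensional ℝ E]

/-- The expression of the Riemannian metric in the chart at `x₀`, a field of bilinear forms on the
model space that is meaningful on the target of the chart. -/
noncomputable def metricInChart (x₀ : X) (η : E) : E →L[ℝ] E →L[ℝ] ℝ :=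
  LinearMap.toContinuousLinearMap (LinearMap.toContinuousLinearMap.toLinearMap ∘ₗ
    LinearMap.mk₂ ℝ
    (fun a b ↦ inner ℝ (chartFrame x₀ ((extChartAt 𝓘(ℝ, E) x₀).symm η) a)
      (chartFrame x₀ ((extChartAt 𝓘(ℝ, E) x₀).symm η) b))
    (fun a b c ↦ by rw [map_add, inner_add_left])
    (fun a b c ↦ by rw [map_smul, real_inner_smul_left, smul_eq_mul])
    (fun a b c ↦ by rw [map_add, inner_add_right])
    (fun a b c ↦ by rw [map_smul, real_inner_smul_right, smul_eq_mul]))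

theorem metricInChart_extChartAt {x₀ y : X} (hy : y ∈ (chartAt E x₀).source) (a b : E) :
    metricInChart x₀ (extChartAt 𝓘(ℝ, E) x₀ y) a b =
      inner ℝ (chartFrame x₀ y a) (chartFrame x₀ y b) := by
  have h : ∀ y', y' = y → (inner ℝ (chartFrame x₀ y' a) (chartFrame x₀ y' b) : ℝ) =
      inner ℝ (chartFrame x₀ y a) (chartFrame x₀ y b) := by rintro _ rfl; rfl
  exact h _ ((extChartAt 𝓘(ℝ, E) x₀).left_inv (by rwa [extChartAt_source]))

variable [IsContMDiffRiemannianBundle 𝓘(ℝ, E) ∞ E (fun x : X ↦ TangentSpace 𝓘(ℝ, E) x)]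

theorem contDiffOn_metricInChart (x₀ : X) :
    ContDiffOn ℝ ∞ (metricInChart x₀) (extChartAt 𝓘(ℝ, E) x₀).target := by
  rw [contDiffOn_clm_apply]
  intro a
  rw [contDiffOn_clm_apply]
  intro b
  rw [← contMDiffOn_iff_contDiffOn]
  exact ContMDiffOn.inner_bundle (E := fun x : X ↦ TangentSpace 𝓘(ℝ, E) x) (F := E)
    (IB := 𝓘(ℝ, E)) (contMDiffOn_chartFrame x₀ a) (contMDiffOn_chartFrame x₀ b)

/-- The metric in the chart is uniformly positive definite near `x₀`. -/
theorem exists_le_metricInChart (x₀ : X) :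
    ∃ m > 0, ∀ᶠ y in nhds x₀, ∀ a : E,
      m * ‖a‖ ^ 2 ≤ metricInChart x₀ (extChartAt 𝓘(ℝ, E) x₀ y) a a := by
  have := isContinuousRiemannianBundle_tangentSpace E X
  obtain ⟨C, C0, hC⟩ := eventually_norm_trivializationAt_lt E
    (fun x : X ↦ TangentSpace 𝓘(ℝ, E) x) x₀
  refine ⟨1 / C ^ 2, by positivity, ?_⟩
  filter_upwards [hC, chart_source_mem_nhds E x₀] with y hy hys a
  have h1 : ‖a‖ ≤ C * ‖chartFrame x₀ y a‖ := by
    conv_lhs => rw [← chartCoframe_chartFrame hys a]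
    exact ContinuousLinearMap.le_of_opNorm_le _ hy.le _
  rw [metricInChart_extChartAt hys, real_inner_self_eq_norm_sq, div_mul_eq_mul_div,
    div_le_iff₀ (by positivity), one_mul]
  calc ‖a‖ ^ 2 ≤ (C * ‖chartFrame x₀ y a‖) ^ 2 := pow_le_pow_left₀ (norm_nonneg _) h1 2
    _ = _ := by ring

set_option maxSynthPendingDepth 3 in
open Filter Topology in
theorem exists_jetBounds (J : AlmostComplexStructure E X) (x₀ : X) :
    ∃ M m : ℝ, 1 ≤ M ∧ 0 < m ∧ ∀ᶠ y in 𝓝 x₀,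
      JetBounds (metricInChart x₀) (J.inChart x₀) M m (extChartAt 𝓘(ℝ, E) x₀ y) := by
  obtain ⟨m, hm, hmy⟩ := exists_le_metricInChart (E := E) x₀
  have hV : IsOpen (extChartAt 𝓘(ℝ, E) x₀).target := isOpen_extChartAt_target x₀
  have hx : extChartAt 𝓘(ℝ, E) x₀ x₀ ∈ (extChartAt 𝓘(ℝ, E) x₀).target :=
    mem_extChartAt_target x₀
  have ev {F : Type _} [NormedAddCommGroup F] [NormedSpace ℝ F] {f : E → F}
      (hf : ContDiffOn ℝ ∞ f (extChartAt 𝓘(ℝ, E) x₀).target) :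
      ∃ C, ∀ᶠ y in 𝓝 x₀, ‖f (extChartAt 𝓘(ℝ, E) x₀ y)‖ ≤ C := by
    have h1 : ContinuousAt (fun y ↦ ‖f (extChartAt 𝓘(ℝ, E) x₀ y)‖) x₀ :=
      (ContinuousAt.comp (f := extChartAt 𝓘(ℝ, E) x₀)
        (hf.continuousOn.continuousAt (hV.mem_nhds hx)) (continuousAt_extChartAt x₀)).norm
    exact ⟨_, (h1.eventually_lt continuousAt_const (lt_add_one _)).mono fun y hy ↦ hy.le⟩
  have hG := contDiffOn_metricInChart (E := E) x₀
  have hJ := J.contDiffOn_inChart x₀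
  have hG1 := ((contDiffOn_infty_iff_fderiv_of_isOpen hV).1 hG).2
  have hJ1 := ((contDiffOn_infty_iff_fderiv_of_isOpen hV).1 hJ).2
  have hG2 := ((contDiffOn_infty_iff_fderiv_of_isOpen hV).1 hG1).2
  have hJ2 := ((contDiffOn_infty_iff_fderiv_of_isOpen hV).1 hJ1).2
  obtain ⟨c1, h1⟩ := ev hG
  obtain ⟨c2, h2⟩ := ev hG1
  obtain ⟨c3, h3⟩ := ev hG2
  obtain ⟨c4, h4⟩ := ev hJ
  obtain ⟨c5, h5⟩ := ev hJ1
  obtain ⟨c6, h6⟩ := ev hJ2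
  set M := max 1 (max c1 (max c2 (max c3 (max c4 (max c5 c6))))) with hM
  refine ⟨M, m, le_max_left _ _, hm, ?_⟩
  filter_upwards [hmy, h1, h2, h3, h4, h5, h6] with y hmy h1 h2 h3 h4 h5 h6
  replace h1 := h1.trans (show c1 ≤ M by simp [hM])
  replace h2 := h2.trans (show c2 ≤ M by simp [hM])
  replace h3 := h3.trans (show c3 ≤ M by simp [hM])
  replace h4 := h4.trans (show c4 ≤ M by simp [hM])
  replace h5 := h5.trans (show c5 ≤ M by simp [hM])
  replace h6 := h6.trans (show c6 ≤ M by simp [hM])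
  refine ⟨fun a ↦ ?_, fun a b ↦ ?_, fun a b c ↦ ?_, fun a b ↦ ?_, fun a b c ↦ ?_,
    fun a b c d ↦ ?_, hmy⟩
  · exact ContinuousLinearMap.le_of_opNorm_le _ h4 _
  · exact ContinuousLinearMap.le_of_opNorm_le _ (ContinuousLinearMap.le_of_opNorm_le _ h5 _) _
  · exact ContinuousLinearMap.le_of_opNorm_le _ (ContinuousLinearMap.le_of_opNorm_le _
      (ContinuousLinearMap.le_of_opNorm_le _ h6 _) _) _
  · exact ContinuousLinearMap.le_of_opNorm_le _ (ContinuousLinearMap.le_of_opNorm_le _ h1 _) _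
  · exact ContinuousLinearMap.le_of_opNorm_le _ (ContinuousLinearMap.le_of_opNorm_le _
      (ContinuousLinearMap.le_of_opNorm_le _ h2 _) _) _
  · exact ContinuousLinearMap.le_of_opNorm_le _ (ContinuousLinearMap.le_of_opNorm_le _
      (ContinuousLinearMap.le_of_opNorm_le _ (ContinuousLinearMap.le_of_opNorm_le _ h3 _) _) _) _

end Metric

section Curves

theorem mapsTo_extChartAt_comp {E X : Type*} [NormedAddCommGroup E] [NormedSpace ℝ E]
    [TopologicalSpace X] [ChartedSpace E X] {u : ℂ → X} {U : Set ℂ} {x₀ : X} :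
    Set.MapsTo (extChartAt 𝓘(ℝ, E) x₀ ∘ u) (U ∩ u ⁻¹' (chartAt E x₀).source)
      (extChartAt 𝓘(ℝ, E) x₀).target := fun z hz ↦
  (extChartAt 𝓘(ℝ, E) x₀).map_source (by rw [extChartAt_source]; exact hz.2)

variable {E : Type*} [NormedAddCommGroup E] [NormedSpace ℝ E]
  {X : Type*} [TopologicalSpace X] [ChartedSpace E X] [IsManifold 𝓘(ℝ, E) ∞ X]
  {J : AlmostComplexStructure E X} {u : ℂ → X} {U : Set ℂ} {z : ℂ} {x₀ : X}

theorem IsJHolomorphicOn.mdifferentiableAt (hu : IsJHolomorphicOn J u U) (hU : IsOpen U)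
    (hz : z ∈ U) : MDifferentiableAt 𝓘(ℝ, ℂ) 𝓘(ℝ, E) u z :=
  (hu.1.contMDiffAt (hU.mem_nhds hz)).mdifferentiableAt (by simp)

theorem IsJHolomorphicOn.isOpen_inter_preimage (hu : IsJHolomorphicOn J u U) (hU : IsOpen U)
    (x₀ : X) : IsOpen (U ∩ u ⁻¹' (chartAt E x₀).source) :=
  hu.1.continuousOn.isOpen_inter_preimage hU (chartAt E x₀).open_source

theorem IsJHolomorphicOn.contDiffOn_extChartAt_comp (hu : IsJHolomorphicOn J u U) :
    ContDiffOn ℝ ∞ (extChartAt 𝓘(ℝ, E) x₀ ∘ u) (U ∩ u ⁻¹' (chartAt E x₀).source) := by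
  rw [← contMDiffOn_iff_contDiffOn]
  exact contMDiffOn_extChartAt.comp (hu.1.mono Set.inter_subset_left) fun z hz ↦ hz.2

theorem AlmostComplexStructure.inChart_extChartAt {y : X} (hy : y ∈ (chartAt E x₀).source)
    (a : E) :
    J.inChart x₀ (extChartAt 𝓘(ℝ, E) x₀ y) a =
      chartCoframe x₀ y (J.toFun y (chartFrame x₀ y a)) := by
  have h : ∀ y', y' = y → chartCoframe x₀ y' (J.toFun y' (chartFrame x₀ y' a)) =
      chartCoframe x₀ y (J.toFun y (chartFrame x₀ y a)) := by rintro _ rfl; rfl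
  exact h _ ((extChartAt 𝓘(ℝ, E) x₀).left_inv (by rwa [extChartAt_source]))

/-- The Cauchy-Riemann equation in the chart at `x₀`. -/
theorem IsJHolomorphicOn.dirDeriv_I (hu : IsJHolomorphicOn J u U) (hU : IsOpen U)
    (hz : z ∈ U ∩ u ⁻¹' (chartAt E x₀).source) :
    dirDeriv Complex.I (extChartAt 𝓘(ℝ, E) x₀ ∘ u) z =
      J.inChart x₀ ((extChartAt 𝓘(ℝ, E) x₀ ∘ u) z) (dirDeriv 1 (extChartAt 𝓘(ℝ, E) x₀ ∘ u) z) := by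
  have hd := hu.mdifferentiableAt hU hz.1
  rw [Function.comp_apply, AlmostComplexStructure.inChart_extChartAt hz.2]
  unfold dirDeriv
  rw [fderiv_extChartAt_comp hd hz.2, fderiv_extChartAt_comp hd hz.2, chartFrame_chartCoframe hz.2,
    ← hu.2 z hz.1, mul_one]

variable [RiemannianBundle (fun x : X ↦ TangentSpace 𝓘(ℝ, E) x)]

/-- As `J` is an isometry, the two partial derivatives of a `J`-holomorphic map have equal norm. -/
theorem IsJHolomorphicOn.normSqDifferential_eq (hu : IsJHolomorphicOn J u U)
    (hJ : J.IsCompatible) (hz : z ∈ U) :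
    normSqDifferential E u z = 2 * ‖mfderiv 𝓘(ℝ, ℂ) 𝓘(ℝ, E) u z (1 : ℂ)‖ ^ 2 := by
  have h := hJ (u z) (mfderiv 𝓘(ℝ, ℂ) 𝓘(ℝ, E) u z (1 : ℂ)) (mfderiv 𝓘(ℝ, ℂ) 𝓘(ℝ, E) u z (1 : ℂ))
  rw [← hu.2 z hz, mul_one, real_inner_self_eq_norm_sq, real_inner_self_eq_norm_sq] at h
  rw [normSqDifferential, h]
  ring

variable [FiniteDimensional ℝ E]

theorem IsJHolomorphicOn.energyDensity_eq_localDensity (hu : IsJHolomorphicOn J u U)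
    (hJ : J.IsCompatible) (hU : IsOpen U) (hz : z ∈ U ∩ u ⁻¹' (chartAt E x₀).source) :
    normSqDifferential E u z / 2 =
      localDensity (metricInChart x₀) (extChartAt 𝓘(ℝ, E) x₀ ∘ u) z := by
  rw [hu.normSqDifferential_eq hJ hz.1, localDensity, Function.comp_apply,
    metricInChart_extChartAt hz.2]
  unfold dirDeriv
  rw [fderiv_extChartAt_comp (hu.mdifferentiableAt hU hz.1) hz.2, chartFrame_chartCoframe hz.2,
    real_inner_self_eq_norm_sq]
  ring

variable [IsContMDiffRiemannianBundle 𝓘(ℝ, E) ∞ E (fun x : X ↦ TangentSpace 𝓘(ℝ, E) x)]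

theorem IsJHolomorphicOn.contDiffOn_energyDensity (hu : IsJHolomorphicOn J u U)
    (hJ : J.IsCompatible) (hU : IsOpen U) :
    ContDiffOn ℝ ∞ (fun z ↦ normSqDifferential E u z / 2) U := by
  intro z hz
  have hW := hu.isOpen_inter_preimage hU (u z)
  have hzW : z ∈ U ∩ u ⁻¹' (chartAt E (u z)).source := ⟨hz, mem_chart_source E (u z)⟩
  have h1 := (contDiffOn_metricInChart (E := E) (u z)).localDensity hW
    hu.contDiffOn_extChartAt_comp mapsTo_extChartAt_comp
  refine ((h1.congr fun w hw ↦ hu.energyDensity_eq_localDensity hJ hU hw).contDiffAt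
    (hW.mem_nhds hzW)).contDiffWithinAt

open Filter Topology in
theorem exists_planeLaplacian_energyDensity_ge_nhds (hJ : J.IsCompatible) (x₀ : X) :
    ∃ A > 0, ∀ᶠ y in 𝓝 x₀, ∀ (u : ℂ → X) (U : Set ℂ), IsOpen U → IsJHolomorphicOn J u U →
      ∀ z ∈ U, u z = y → -(A * (normSqDifferential E u z / 2) ^ 2) ≤
        planeLaplacian (fun z ↦ normSqDifferential E u z / 2) z := by
  obtain ⟨M, m, hM, hm, hb⟩ := exists_jetBounds J x₀
  refine ⟨(50 * M ^ 6 / m + 16 * M ^ 3) / m ^ 2, by positivity, ?_⟩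
  filter_upwards [hb, chart_source_mem_nhds E x₀] with y hb hys u U hU hu z hz hzy
  subst hzy
  have hW := hu.isOpen_inter_preimage hU x₀
  have hzW : z ∈ U ∩ u ⁻¹' (chartAt E x₀).source := ⟨hz, hys⟩
  have heq : (fun z ↦ normSqDifferential E u z / 2) =ᶠ[𝓝 z]
      localDensity (metricInChart x₀) (extChartAt 𝓘(ℝ, E) x₀ ∘ u) :=
    eventuallyEq_of_mem (hW.mem_nhds hzW) fun w hw ↦ hu.energyDensity_eq_localDensity hJ hU hw
  rw [planeLaplacian_congr heq, hu.energyDensity_eq_localDensity hJ hU hzW]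
  exact planeLaplacian_localDensity_ge (isOpen_extChartAt_target x₀) hW
    (contDiffOn_metricInChart x₀) (J.contDiffOn_inChart x₀) hu.contDiffOn_extChartAt_comp
    mapsTo_extChartAt_comp (fun η hη a ↦ J.inChart_sq x₀ hη a)
    (fun ζ hζ ↦ hu.dirDeriv_I hU hζ) hzW hM hm hb

open Filter Topology in
/-- The differential inequality `Δφ ≥ -Aφ²` for the energy densities `φ` of `J`-holomorphic maps,
with a constant that depends only on a compact set containing the image. -/
theorem exists_planeLaplacian_energyDensity_ge (hJ : J.IsCompatible) {K : Set X}
    (hK : IsCompact K) :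
    ∃ A > 0, ∀ (u : ℂ → X) (U : Set ℂ), IsOpen U → IsJHolomorphicOn J u U →
      ∀ z ∈ U, u z ∈ K → -(A * (normSqDifferential E u z / 2) ^ 2) ≤
        planeLaplacian (fun z ↦ normSqDifferential E u z / 2) z := by
  refine hK.induction_on (p := fun K ↦ ∃ A > 0, ∀ (u : ℂ → X) (U : Set ℂ), IsOpen U →
    IsJHolomorphicOn J u U → ∀ z ∈ U, u z ∈ K → -(A * (normSqDifferential E u z / 2) ^ 2) ≤
        planeLaplacian (fun z ↦ normSqDifferential E u z / 2) z) ?_ ?_ ?_ ?_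
  · exact ⟨1, one_pos, fun _ _ _ _ _ _ h ↦ h.elim⟩
  · rintro s t hst ⟨A, hA, h⟩
    exact ⟨A, hA, fun u U hU hu z hz hzs ↦ h u U hU hu z hz (hst hzs)⟩
  · rintro s t ⟨A, hA, h⟩ ⟨B, hB, h'⟩
    refine ⟨max A B, lt_max_of_lt_left hA, fun u U hU hu z hz hzs ↦ ?_⟩
    rcases hzs with hzs | hzs
    · refine le_trans (neg_le_neg ?_) (h u U hU hu z hz hzs)
      exact mul_le_mul_of_nonneg_right (le_max_left _ _) (sq_nonneg _)
    · refine le_trans (neg_le_neg ?_) (h' u U hU hu z hz hzs)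
      exact mul_le_mul_of_nonneg_right (le_max_right _ _) (sq_nonneg _)
  · intro x _
    obtain ⟨A, hA, h⟩ := exists_planeLaplacian_energyDensity_ge_nhds (E := E) hJ x
    exact ⟨_, mem_nhdsWithin_of_mem_nhds h, A, hA, fun u U hU hu z hz hzs ↦
      hzs u U hU hu z hz rfl⟩

end Curves

/-! ### Energy, constancy and relatively compact balls -/

section Constancy

variable {E : Type*} [NormedAddCommGroup E] [NormedSpace ℝ E]
  {X : Type*} [TopologicalSpace X] [ChartedSpace E X] [IsManifold 𝓘(ℝ, E) ∞ X]
  {J : AlmostComplexStructure E X} {u : ℂ → X} {U : Set ℂ}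

open Filter Topology in
theorem IsJHolomorphicOn.eventually_eq_of_mfderiv_eq_zero (hu : IsJHolomorphicOn J u U)
    (hU : IsOpen U) (h0 : ∀ z ∈ U, mfderiv 𝓘(ℝ, ℂ) 𝓘(ℝ, E) u z = 0) {z : ℂ} (hz : z ∈ U) :
    ∀ᶠ w in 𝓝 z, u w = u z := by
  have hW := hu.isOpen_inter_preimage hU (u z)
  have hzW : z ∈ U ∩ u ⁻¹' (chartAt E (u z)).source := ⟨hz, mem_chart_source E (u z)⟩
  obtain ⟨ε, ε0, hε⟩ := Metric.isOpen_iff.1 hW z hzW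
  filter_upwards [Metric.ball_mem_nhds z ε0] with w hw
  have h1 : (extChartAt 𝓘(ℝ, E) (u z) ∘ u) w = (extChartAt 𝓘(ℝ, E) (u z) ∘ u) z := by
    refine Metric.isOpen_ball.is_const_of_fderiv_eq_zero (𝕜 := ℝ)
      (convex_ball z ε).isPreconnected
      ((hu.contDiffOn_extChartAt_comp.mono hε).differentiableOn (by simp)) ?_ hw
      (Metric.mem_ball_self ε0)
    intro ζ hζ
    ext1 h
    rw [fderiv_extChartAt_comp (hu.mdifferentiableAt hU (hε hζ).1) (hε hζ).2, h0 ζ (hε hζ).1]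
    exact map_zero _
  refine (extChartAt 𝓘(ℝ, E) (u z)).injOn ?_ ?_ h1
  · rw [extChartAt_source]; exact (hε hw).2
  · exact mem_extChartAt_source (u z)

theorem IsJHolomorphicOn.exists_eq_const (hu : IsJHolomorphicOn J u U)
    (hU : IsOpen U) (hUc : IsPreconnected U) (hUn : U.Nonempty)
    (h0 : ∀ z ∈ U, mfderiv 𝓘(ℝ, ℂ) 𝓘(ℝ, E) u z = 0) :
    ∃ c, ∀ z ∈ U, u z = c := by
  obtain ⟨z₀, hz₀⟩ := hUn
  have : PreconnectedSpace U := isPreconnected_iff_preconnectedSpace.1 hUc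
  have hloc : IsLocallyConstant (fun z : U ↦ u z) := by
    rw [IsLocallyConstant.iff_eventually_eq]
    intro z
    exact continuous_subtype_val.continuousAt.eventually
      (hu.eventually_eq_of_mfderiv_eq_zero hU h0 z.2)
  exact ⟨u z₀, fun z hz ↦ hloc.apply_eq_of_preconnectedSpace ⟨z, hz⟩ ⟨z₀, hz₀⟩⟩

end Constancy

section Energy

theorem clm_eq_zero_of_apply_one_of_apply_I {F : Type*} [NormedAddCommGroup F] [NormedSpace ℝ F]
    {L : ℂ →L[ℝ] F} (h1 : L 1 = 0) (hI : L Complex.I = 0) : L = 0 := by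
  refine ContinuousLinearMap.ext fun v ↦ ?_
  have hv : v = v.re • (1 : ℂ) + v.im • Complex.I := by
    rw [Complex.real_smul, Complex.real_smul, mul_one, Complex.re_add_im]
  calc L v = L (v.re • (1 : ℂ) + v.im • Complex.I) := congrArg L hv
    _ = 0 := by rw [map_add, map_smul, map_smul, h1, hI, smul_zero, smul_zero, add_zero]

variable {E : Type*} [NormedAddCommGroup E] [NormedSpace ℝ E]
  {X : Type*} [TopologicalSpace X] [ChartedSpace E X]
  [RiemannianBundle (fun x : X ↦ TangentSpace 𝓘(ℝ, E) x)]

theorem normSqDifferential_nonneg (u : ℂ → X) (z : ℂ) : 0 ≤ normSqDifferential E u z := by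
  unfold normSqDifferential; positivity

theorem energy_eq_lintegral (u : ℂ → X) (U : Set ℂ) :
    energy E u U = ∫⁻ z in U, ENNReal.ofReal (normSqDifferential E u z / 2) := by
  rw [energy, ← lintegral_const_mul' _ _ (by simp)]
  refine lintegral_congr fun z ↦ ?_
  rw [div_eq_inv_mul, ENNReal.ofReal_mul (by norm_num), ENNReal.ofReal_inv_of_pos two_pos]
  simp

theorem mfderiv_eq_zero_of_normSqDifferential_eq_zero {u : ℂ → X} {z : ℂ}
    (h : normSqDifferential E u z = 0) : mfderiv 𝓘(ℝ, ℂ) 𝓘(ℝ, E) u z = 0 := by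
  have h1 : mfderiv 𝓘(ℝ, ℂ) 𝓘(ℝ, E) u z (1 : ℂ) = 0 := by
    rw [← norm_eq_zero, ← sq_eq_zero_iff]
    unfold normSqDifferential at h
    nlinarith [sq_nonneg ‖mfderiv 𝓘(ℝ, ℂ) 𝓘(ℝ, E) u z (1 : ℂ)‖,
      sq_nonneg ‖mfderiv 𝓘(ℝ, ℂ) 𝓘(ℝ, E) u z (Complex.I : ℂ)‖]
  have h2 : mfderiv 𝓘(ℝ, ℂ) 𝓘(ℝ, E) u z (Complex.I : ℂ) = 0 := by
    rw [← norm_eq_zero, ← sq_eq_zero_iff]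
    unfold normSqDifferential at h
    nlinarith [sq_nonneg ‖mfderiv 𝓘(ℝ, ℂ) 𝓘(ℝ, E) u z (1 : ℂ)‖,
      sq_nonneg ‖mfderiv 𝓘(ℝ, ℂ) 𝓘(ℝ, E) u z (Complex.I : ℂ)‖]
  exact clm_eq_zero_of_apply_one_of_apply_I (F := TangentSpace 𝓘(ℝ, E) (u z)) h1 h2

end Energy

section MeanValue

variable {E : Type*} [NormedAddCommGroup E] [NormedSpace ℝ E]
  {X : Type*} [TopologicalSpace X] [ChartedSpace E X] [IsManifold 𝓘(ℝ, E) ∞ X]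
  [RiemannianBundle (fun x : X ↦ TangentSpace 𝓘(ℝ, E) x)]

variable [FiniteDimensional ℝ E]
  [IsContMDiffRiemannianBundle 𝓘(ℝ, E) ∞ E (fun x : X ↦ TangentSpace 𝓘(ℝ, E) x)]
  {J : AlmostComplexStructure E X}

theorem IsJHolomorphicOn.exists_eq_const_of_energy_eq_zero {u : ℂ → X} {U : Set ℂ}
    (hu : IsJHolomorphicOn J u U) (hJ : J.IsCompatible)
    (hU : IsOpen U) (hUc : IsPreconnected U) (hUn : U.Nonempty) (h : energy E u U = 0) :
    ∃ c, ∀ z ∈ U, u z = c := by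
  refine hu.exists_eq_const hU hUc hUn fun z hz ↦ mfderiv_eq_zero_of_normSqDifferential_eq_zero ?_
  have hc := (hu.contDiffOn_energyDensity hJ hU).continuousOn
  rw [energy_eq_lintegral, lintegral_eq_zero_iff'
    (hc.aemeasurable hU.measurableSet).ennreal_ofReal] at h
  have h1 : (fun z ↦ normSqDifferential E u z / 2) =ᵐ[volume.restrict U] fun _ ↦ (0 : ℝ) := by
    filter_upwards [h] with z hz
    have := ENNReal.ofReal_eq_zero.1 hz
    have := normSqDifferential_nonneg (E := E) u z
    linarith
  have := Measure.eqOn_open_of_ae_eq h1 hU hc continuousOn_const hz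
  simp only at this
  linarith

/-- The mean value inequality for `J`-holomorphic maps into a fixed compact set. -/
theorem exists_mean_value_of_isCompact (hJ : J.IsCompatible) {K : Set X} (hK : IsCompact K) :
    ∃ c : ℝ, 0 < c ∧ ∀ (R : ℝ) (u : ℂ → X), 0 < R → IsJHolomorphicOn J u (Metric.ball 0 R) →
      u '' Metric.ball 0 R ⊆ K → energy E u (Metric.ball 0 R) < ENNReal.ofReal c →
      normSqDifferential E u 0 ≤
          16 / (Real.pi * R ^ 2) * (energy E u (Metric.ball 0 R)).toReal ∧
        ((¬ ∃ c : X, ∀ z ∈ Metric.ball (0 : ℂ) R, u z = c) →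
          normSqDifferential E u 0 <
            16 / (Real.pi * R ^ 2) * (energy E u (Metric.ball 0 R)).toReal) := by
  obtain ⟨A, hA, hΔ⟩ := exists_planeLaplacian_energyDensity_ge (E := E) hJ hK
  refine ⟨3 * Real.pi / (32 * A), by positivity, fun R u hR hu huK hE ↦ ?_⟩
  have hpi := Real.pi_pos
  have hc := hu.contDiffOn_energyDensity hJ Metric.isOpen_ball
  have hfin : energy E u (Metric.ball 0 R) ≠ ⊤ := (hE.trans ENNReal.ofReal_lt_top).ne
  have key := heinz_ball hR hc
    (fun z _ ↦ div_nonneg (normSqDifferential_nonneg u z) two_pos.le) hA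
    (fun z hz ↦ hΔ u _ Metric.isOpen_ball hu z hz (huK ⟨z, hz, rfl⟩))
    (e := (energy E u (Metric.ball 0 R)).toReal) ENNReal.toReal_nonneg ?_
    ((ENNReal.lt_ofReal_iff_toReal_lt hfin).1 hE)
  · set e := (energy E u (Metric.ball 0 R)).toReal with he
    have e0 : 0 ≤ e := ENNReal.toReal_nonneg
    have h1 : normSqDifferential E u 0 ≤ 32 / 3 / (Real.pi * R ^ 2) * e := by
      rw [div_mul_eq_mul_div, le_div_iff₀ (by positivity)]
      rw [le_div_iff₀ hpi] at key
      linarith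
    have h2 : 32 / 3 / (Real.pi * R ^ 2) < 16 / (Real.pi * R ^ 2) := by
      gcongr; norm_num
    refine ⟨h1.trans (mul_le_mul_of_nonneg_right h2.le e0), fun hconst ↦ h1.trans_lt ?_⟩
    refine mul_lt_mul_of_pos_right h2 (e0.lt_of_ne fun h ↦ hconst ?_)
    have h3 : energy E u (Metric.ball 0 R) = 0 :=
      ((ENNReal.toReal_eq_zero_iff _).1 h.symm).resolve_right hfin
    exact hu.exists_eq_const_of_energy_eq_zero hJ Metric.isOpen_ball
      (convex_ball 0 R).isPreconnected ⟨0, Metric.mem_ball_self hR⟩ h3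
  · intro z r _ hzr
    have hsub := Metric.ball_subset_closedBall.trans hzr
    rw [integral_eq_lintegral_of_nonneg_ae
      (Filter.Eventually.of_forall fun z ↦ div_nonneg (normSqDifferential_nonneg u z) two_pos.le)
      ((hc.continuousOn.mono hsub).aestronglyMeasurable Metric.isOpen_ball.measurableSet)]
    refine ENNReal.toReal_mono hfin ?_
    rw [energy_eq_lintegral]
    exact lintegral_mono_set hsub

end MeanValue

section Balls

variable {E : Type*} [NormedAddCommGroup E] [NormedSpace ℝ E] [FiniteDimensional ℝ E]
  {X : Type*} [TopologicalSpace X] [T2Space X]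
  [ChartedSpace E X] [IsManifold 𝓘(ℝ, E) ∞ X]
  [RiemannianBundle (fun x : X ↦ TangentSpace 𝓘(ℝ, E) x)]
  [IsContMDiffRiemannianBundle 𝓘(ℝ, E) ∞ E (fun x : X ↦ TangentSpace 𝓘(ℝ, E) x)]

open Filter Topology Set in
/-- If the ball of radius `r₀` about `x₀` is relatively compact, then all balls with nearby centre
and radius lie in one compact set: a path from `x₀` of length slightly more than `r₀` stays close
to the closed ball. In particular the pairs with relatively compact ball form an open set. -/
theorem exists_isCompact_eventually_riemannianBall_subset {x₀ : X} {r₀ : ℝ}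
    (h : (x₀, r₀) ∈ relativelyCompactBalls E X) :
    ∃ K : Set X, IsCompact K ∧ ∀ᶠ p : X × ℝ in 𝓝 (x₀, r₀), riemannianBall E p.1 p.2 ⊆ K := by
  have := isContinuousRiemannianBundle_tangentSpace E X
  have : LocallyCompactSpace X := Manifold.locallyCompact_of_finiteDimensional 𝓘(ℝ, E)
  have : IsManifold 𝓘(ℝ, E) 1 X := IsManifold.of_le (n := ∞) (by simp)
  let : PseudoEMetricSpace X := PseudoEMetricSpace.ofRiemannianMetric 𝓘(ℝ, E) X
  have h' : IsCompact (closure (riemannianBall E x₀ r₀)) := h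
  -- for `r₀ ≤ 0` the ball is empty, so the centre is added by hand
  set K₀ := insert x₀ (closure (riemannianBall E x₀ r₀)) with hK₀
  have hK₀c : IsCompact K₀ := h'.insert x₀
  obtain ⟨K, hK, hK₀K⟩ := exists_compact_superset hK₀c
  obtain ⟨δ, δ0, hδ⟩ := hK₀c.exists_thickening_subset_open isOpen_interior hK₀K
  refine ⟨K, hK, ?_⟩
  have hbig : ∀ y, edist x₀ y < ENNReal.ofReal (r₀ + δ / 2) → y ∈ K := by
    intro y hy
    refine interior_subset (hδ ?_)
    rw [Metric.mem_thickening_iff_exists_edist_lt]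
    by_cases h1 : edist x₀ y < ENNReal.ofReal δ
    · exact ⟨x₀, mem_insert _ _, by rwa [edist_comm]⟩
    by_cases h2 : edist x₀ y < ENNReal.ofReal r₀
    · exact ⟨y, mem_insert_of_mem _ (subset_closure h2), by simpa using δ0⟩
    push Not at h1 h2
    have hr₀ : δ / 2 < r₀ := by
      have := ENNReal.ofReal_lt_ofReal_iff'.1 (h1.trans_lt hy)
      linarith [this.1]
    obtain ⟨γ, γ0, γ1, hγ, hL⟩ := exists_lt_of_riemannianEDist_lt (I := 𝓘(ℝ, E)) (x := x₀) (y := y)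
      (r := ENNReal.ofReal (r₀ + δ / 2)) hy
    have hcont : ContinuousOn (fun t ↦ edist x₀ (γ t)) (Icc 0 1) :=
      (continuous_const.edist continuous_id).comp_continuousOn hγ.continuousOn
    -- the path passes at distance `r₀ - δ / 4` from `x₀`, and its remainder is shorter than `δ`
    obtain ⟨t, ht, hts⟩ := intermediate_value_Icc (zero_le_one (α := ℝ)) hcont
      (show ENNReal.ofReal (r₀ - δ / 4) ∈ _ by
        refine ⟨by simp [γ0], ?_⟩
        rw [γ1]
        exact (ENNReal.ofReal_le_ofReal (by linarith)).trans h2)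
    simp only at hts
    refine ⟨γ t, mem_insert_of_mem _ (subset_closure ?_), ?_⟩
    · change edist x₀ (γ t) < _
      rw [hts]
      exact (ENNReal.ofReal_lt_ofReal_iff (by linarith)).2 (by linarith)
    · by_contra hcon
      push Not at hcon
      have l1 : edist x₀ (γ t) ≤ pathELength 𝓘(ℝ, E) γ 0 t :=
        riemannianEDist_le_pathELength (hγ.mono (Icc_subset_Icc_right ht.2)) γ0 rfl ht.1
      have l2 : edist (γ t) y ≤ pathELength 𝓘(ℝ, E) γ t 1 :=
        riemannianEDist_le_pathELength (hγ.mono (Icc_subset_Icc_left ht.1)) rfl γ1 ht.2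
      have l3 := add_le_add l1 l2
      rw [pathELength_add ht.1 ht.2, hts, edist_comm] at l3
      have l4 : ENNReal.ofReal (r₀ - δ / 4 + δ) < ENNReal.ofReal (r₀ + δ / 2) := by
        rw [ENNReal.ofReal_add (by linarith) δ0.le]
        exact ((add_le_add_right hcon _).trans l3).trans_lt hL
      have l5 := (ENNReal.ofReal_lt_ofReal_iff'.1 l4).1
      linarith
  have hx : ∀ᶠ x in 𝓝 x₀, edist x₀ x < ENNReal.ofReal (δ / 4) :=
    eventually_riemannianEDist_lt 𝓘(ℝ, E) x₀ (by simpa using δ0)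
  have hr : ∀ᶠ r in 𝓝 r₀, r < r₀ + δ / 4 := eventually_lt_nhds (by linarith)
  have hxr : ∀ᶠ p : X × ℝ in 𝓝 (x₀, r₀),
      edist x₀ p.1 < ENNReal.ofReal (δ / 4) ∧ p.2 < r₀ + δ / 4 :=
    (continuous_fst.tendsto (x₀, r₀) |>.eventually hx).and
      (continuous_snd.tendsto (x₀, r₀) |>.eventually hr)
  filter_upwards [hxr] with p hp y hy
  have hy' : edist p.1 y < ENNReal.ofReal p.2 := hy
  refine hbig y ?_
  have hp2 : 0 < p.2 := ENNReal.ofReal_pos.1 (bot_le.trans_lt hy')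
  calc edist x₀ y ≤ edist x₀ p.1 + edist p.1 y := edist_triangle _ _ _
    _ < ENNReal.ofReal (δ / 4) + ENNReal.ofReal p.2 := ENNReal.add_lt_add hp.1 hy'
    _ = ENNReal.ofReal (δ / 4 + p.2) := (ENNReal.ofReal_add (by linarith) hp2.le).symm
    _ ≤ _ := ENNReal.ofReal_le_ofReal (by linarith [hp.2])

end Balls

open Filter Topology in
/-- On a subset of a metrizable space, a downward closed condition on a positive constant that can
be met locally by a constant can be met by a positive continuous function. -/
theorem exists_continuousOn_of_local_const {Y : Type*} [TopologicalSpace Y]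
    [TopologicalSpace.MetrizableSpace Y] (D : Set Y) (P : Y → ℝ → Prop)
    (hP : ∀ p c c', c ≤ c' → P p c' → P p c)
    (hloc : ∀ p ∈ D, ∃ c > 0, ∀ᶠ q in 𝓝 p, P q c) :
    ∃ h : Y → ℝ, (∀ p, 0 < h p) ∧ ContinuousOn h D ∧ ∀ p ∈ D, P p (h p) := by
  let := TopologicalSpace.metrizableSpaceMetric Y
  obtain ⟨g, hg⟩ := exists_continuous_forall_mem_convex_of_local_const
    (X := D) (t := fun p ↦ {c : ℝ | 0 < c ∧ P p c}) (fun p ↦ Set.OrdConnected.convex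
      ⟨fun a ha b hb c hc ↦ ⟨ha.1.trans_le hc.1, hP _ _ _ hc.2 hb.2⟩⟩) fun p ↦ by
      obtain ⟨c, c0, hc⟩ := hloc p p.2
      exact ⟨c, (continuous_subtype_val.continuousAt.eventually hc).mono fun q hq ↦ ⟨c0, hq⟩⟩
  classical
  refine ⟨fun p ↦ if hp : p ∈ D then g ⟨p, hp⟩ else 1, fun p ↦ ?_, ?_, fun p hp ↦ ?_⟩
  · by_cases hp : p ∈ D
    · simpa [hp] using (hg ⟨p, hp⟩).1
    · simp [hp]
  · rw [continuousOn_iff_continuous_domRestrict]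
    convert! g.continuous using 1
    ext p
    simp
  · simpa [hp] using (hg ⟨p, hp⟩).2

/-! ### The mean value inequality -/

theorem proposition4p1
    {E : Type*} [NormedAddCommGroup E] [NormedSpace ℝ E] [FiniteDimensional ℝ E]
    {X : Type*} [TopologicalSpace X] [T2Space X] [SecondCountableTopology X]
    [ChartedSpace E X] [IsManifold 𝓘(ℝ, E) ∞ X]
    [RiemannianBundle (fun x : X ↦ TangentSpace 𝓘(ℝ, E) x)]
    [IsContMDiffRiemannianBundle 𝓘(ℝ, E) ∞ E (fun x : X ↦ TangentSpace 𝓘(ℝ, E) x)]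
    (J : AlmostComplexStructure E X) (hJ : J.IsCompatible) :
    ∃ h : X × ℝ → ℝ, (∀ p, 0 < h p) ∧ ContinuousOn h (relativelyCompactBalls E X) ∧
      ∀ (R : ℝ) (u : ℂ → X) (x : X) (r : ℝ), 0 < R →
        IsJHolomorphicOn J u (Metric.ball 0 R) →
        (x, r) ∈ relativelyCompactBalls E X →
        u '' Metric.ball 0 R ⊆ riemannianBall E x r →
        energy E u (Metric.ball 0 R) < ENNReal.ofReal (h (x, r)) →
        normSqDifferential E u 0 ≤
            16 / (Real.pi * R ^ 2) * (energy E u (Metric.ball 0 R)).toReal ∧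
          ((¬ ∃ c : X, ∀ z ∈ Metric.ball (0 : ℂ) R, u z = c) →
            normSqDifferential E u 0 <
              16 / (Real.pi * R ^ 2) * (energy E u (Metric.ball 0 R)).toReal) := by
  have : LocallyCompactSpace X := Manifold.locallyCompact_of_finiteDimensional 𝓘(ℝ, E)
  have : TopologicalSpace.MetrizableSpace X := Manifold.metrizableSpace 𝓘(ℝ, E) X
  obtain ⟨h, h0, hc, hh⟩ := exists_continuousOn_of_local_const (relativelyCompactBalls E X)
    (fun p c ↦ ∀ (R : ℝ) (u : ℂ → X), 0 < R → IsJHolomorphicOn J u (Metric.ball 0 R) →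
      u '' Metric.ball 0 R ⊆ riemannianBall E p.1 p.2 →
      energy E u (Metric.ball 0 R) < ENNReal.ofReal c →
      normSqDifferential E u 0 ≤
          16 / (Real.pi * R ^ 2) * (energy E u (Metric.ball 0 R)).toReal ∧
        ((¬ ∃ c : X, ∀ z ∈ Metric.ball (0 : ℂ) R, u z = c) →
          normSqDifferential E u 0 <
            16 / (Real.pi * R ^ 2) * (energy E u (Metric.ball 0 R)).toReal))
    (fun p c c' hcc hP R u hR hu hp hE ↦
      hP R u hR hu hp (hE.trans_le (ENNReal.ofReal_le_ofReal hcc)))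
    (by
      rintro ⟨x, r⟩ hp
      obtain ⟨K, hK, hKp⟩ := exists_isCompact_eventually_riemannianBall_subset hp
      obtain ⟨c, c0, hc⟩ := exists_mean_value_of_isCompact (E := E) hJ hK
      exact ⟨c, c0, hKp.mono fun q hq R u hR hu hu' hE ↦ hc R u hR hu (hu'.trans hq) hE⟩)
  exact ⟨h, h0, hc, fun R u x r hR hu hxr hux hE ↦ hh (x, r) hxr R u hR hu hux hE⟩
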